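/- Let $H$ be the Hilbert space of one bosonic mode, with its orthonormal basis of Fock states $|0\rangle,|1\rangle,\dots$. A state is a positive operator on $H$ of trace one; $S(\rho)=-\operatorname{Tr}(\rho\log\rho)\in[0,\infty]$ is the von Neumann entropy; and the minimum output entropy of a channel $\Phi$ is $\inf_\rho S(\Phi(\rho))$ over all states $\rho$. Let $\delta$ be the Kronecker symbol and $0^0=1$. Define, for $m_1,m_2,n_1,n_2\ge 0$, $$T[\mathcal A(\kappa)]^{m_1,m_2}_{n_1,n_2}=\kappa^{-1}\sqrt{\tfrac{n_1!\,m_2!}{m_1!\,n_2!}}\sum_{r=0}^{n_2}\sum_{j=0}^{m_1}\tbinom{n_2}{r}\tbinom{m_1}{j}(-1)^r\kappa^{-(n_2+j-r)}\bigl(\sqrt{1-\kappa^{-2}}\bigr)^{m_1+r-j}\delta_{n_1,r+j}\,\delta_{m_2,n_2+m_1-r-j}\qquad(\kappa\ge1),$$ $$T[\mathcal B(\kappa)]^{m_1,m_2}_{n_1,n_2}=\sqrt{\tfrac{m_1!\,m_2!}{n_1!\,n_2!}}\sum_{r=0}^{n_1}\sum_{j=0}^{n_2}\tbinom{n_1}{r}\tbinom{n_2}{j}(-1)^{n_2-j}\kappa^{n_1-r+j}\bigl(\sqrt{1-\kappa^{2}}\bigr)^{r+n_2-j}\delta_{m_2,r+j}\,\delta_{m_1,n_1+n_2-r-j}\qquad(0\le\kappa\le1),$$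 $$T[\mathcal C(\kappa)]^{m_1,m_2}_{n_1,n_2}=\tfrac{1}{\sqrt{1+\kappa^2}}\sqrt{\tfrac{n_2!\,m_2!}{m_1!\,n_1!}}\sum_{r=0}^{m_1}\sum_{j=0}^{n_1}\tbinom{m_1}{r}\tbinom{n_1}{j}(-1)^j\bigl(\sqrt{1+\kappa^{2}}\bigr)^{-(n_1+r-j)}\Bigl(\tfrac{\kappa}{\sqrt{1+\kappa^{2}}}\Bigr)^{m_1-r+j}\delta_{n_2,r+j}\,\delta_{m_2,n_1+m_1-r-j}\qquad(\kappa\ge0).$$ These are the Fock matrix elements $\langle m_1,m_2|U|n_1,n_2\rangle$ of the two-mode squeezer, the beamsplitter and the phase-conjugation unitary; the first mode is the system, the second the environment. For $\Phi\in\{\mathcal A,\mathcal B,\mathcal C\}$ and $n\ge0$, the $n$ photon-added amplifier, attenuator, respectively phase-conjugation channel is $$\Phi(\kappa;n)[\rho]=\operatorname{Tr}_E\bigl[U(\rho\otimes|n\rangle\langle n|)U^\dagger\bigr]=\sum_{\ell\ge0}K_\ell\,\rho\,K_\ell^\dagger,\qquad \langle m|K_\ell|k\rangle=T[\Phi(\kappa)]^{m,\ell}_{k,n}.$$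 Then for every integer $n\ge 0$: 1. for every real $\kappa\ge1$, the channels $\mathcal A(\kappa;n)$ and $\mathcal C(\sqrt{\kappa^2-1};n)$ have the same minimum output entropy; 2. for every real $0\le\kappa\le1$, the channels $\mathcal B(\kappa;n)$ and $\mathcal B(\sqrt{1-\kappa^2};n)$ have the same minimum output entropy. Here all four channels are well defined: the matrix elements above determine bounded operators $K_\ell$ with $\sum_\ell K_\ell^\dagger K_\ell=1$. -/

import Mathlib

open scoped ENNReal

noncomputable section

namespace PhotonAdded

/-! ### States and entropy of one bosonic mode

The Hilbert space of a single mode is a complex Hilbert space `H` with its orthonormal basis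
`e k = |k⟩` of Fock (number) states, `k = 0, 1, 2, …`. -/

section Mode

variable {H : Type*} [NormedAddCommGroup H] [InnerProductSpace ℂ H]

/-- The trace `∑ₖ ⟨k| A |k⟩ ∈ [0, ∞]` of a positive operator `A`. -/
def trace (e : HilbertBasis ℕ ℂ H) (A : H →L[ℂ] H) : ℝ≥0∞ :=
  ∑' k : ℕ, ENNReal.ofReal (RCLike.re (inner ℂ (e k) (A (e k))))

/-- Density operators (states): positive operators with trace one. -/
def IsDensityOperator (e : HilbertBasis ℕ ℂ H) (ρ : H →L[ℂ] H) : Prop :=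
  ρ.IsPositive ∧ trace e ρ = 1

/-- The von Neumann entropy `S(ρ) = - Tr (ρ log ρ) ∈ [0, ∞]` of a density operator, where the
positive operator `- ρ log ρ` is given by the continuous functional calculus of `x ↦ - x log x`. -/
def vonNeumannEntropy [CompleteSpace H] (e : HilbertBasis ℕ ℂ H) (ρ : H →L[ℂ] H) : ℝ≥0∞ :=
  trace e (cfc Real.negMulLog ρ)

/-- The minimum output entropy of a map `Φ`: the infimum of `S(Φ(ρ))` over all states `ρ`. -/
def minOutputEntropy [CompleteSpace H] (e : HilbertBasis ℕ ℂ H)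
    (Φ : (H →L[ℂ] H) → (H →L[ℂ] H)) : ℝ≥0∞ :=
  ⨅ (ρ : H →L[ℂ] H) (_ : IsDensityOperator e ρ), vonNeumannEntropy e (Φ ρ)

/-! ### Channels from the Fock matrix elements of a two-mode unitary -/

/-- `A` has the Fock matrix elements `⟨m| A |k⟩ = M m k`. -/
def HasFockMatrix (e : HilbertBasis ℕ ℂ H) (A : H →L[ℂ] H) (M : ℕ → ℕ → ℂ) : Prop :=
  ∀ m k : ℕ, inner ℂ (e m) (A (e k)) = M m k

/-- A bounded operator is determined by its Fock matrix elements. -/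
theorem HasFockMatrix.unique {e : HilbertBasis ℕ ℂ H} {A B : H →L[ℂ] H} {M : ℕ → ℕ → ℂ}
    (hA : HasFockMatrix e A M) (hB : HasFockMatrix e B M) : A = B := by
  have key : ∀ k, A (e k) = B (e k) := by
    intro k
    apply e.repr.injective
    ext m
    rw [e.repr_apply_apply, e.repr_apply_apply]
    exact (hA m k).trans (hB m k).symm
  ext x
  have h : ∀ C : H →L[ℂ] H, HasSum (fun k => e.repr x k • C (e k)) (C x) := by
    intro C
    simpa using C.hasSum (e.hasSum_repr x)
  have hx := h A
  simp only [key] at hx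
  exact hx.unique (h B)

open Classical in
/-- The bounded operator with given Fock matrix elements (and `0` if there is none). -/
def ofFockMatrix (e : HilbertBasis ℕ ℂ H) (M : ℕ → ℕ → ℂ) : H →L[ℂ] H :=
  if h : ∃ A : H →L[ℂ] H, HasFockMatrix e A M then h.choose else 0

/-- Let `T m₁ m₂ n₁ n₂ = ⟨m₁, m₂| U |n₁, n₂⟩` be the Fock matrix elements of a two-mode unitary
`U`, the first mode being the system and the second the environment. With the environment prepared
in the Fock state `|n⟩`, this is the Kraus operator `K_ℓ = ⟨ℓ|_E U |n⟩_E`, whose Fock matrix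
elements are `⟨m| K_ℓ |k⟩ = T m ℓ k n`. -/
def kraus (e : HilbertBasis ℕ ℂ H) (T : ℕ → ℕ → ℕ → ℕ → ℝ) (n ℓ : ℕ) : H →L[ℂ] H :=
  ofFockMatrix e fun m k => (T m ℓ k n : ℂ)

/-- The `n` photon-added channel with underlying two-mode unitary `U`:
`ρ ↦ Tr_E [U (ρ ⊗ |n⟩⟨n|) U†] = ∑_ℓ K_ℓ ρ K_ℓ†` (for a state `ρ` the series converges in trace
norm, hence also in operator norm). -/
def photonAddedChannel [CompleteSpace H] (e : HilbertBasis ℕ ℂ H) (T : ℕ → ℕ → ℕ → ℕ → ℝ)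
    (n : ℕ) (ρ : H →L[ℂ] H) : H →L[ℂ] H :=
  ∑' ℓ : ℕ, kraus e T n ℓ ∘L ρ ∘L ContinuousLinearMap.adjoint (kraus e T n ℓ)

/-- The matrix elements `T` really give a family of Kraus operators `K_ℓ` of a channel: each `K_ℓ`
exists as a bounded operator with the prescribed matrix elements, and `∑_ℓ K_ℓ† K_ℓ = 1`. -/
def IsKrausFamily (e : HilbertBasis ℕ ℂ H) (T : ℕ → ℕ → ℕ → ℕ → ℝ) (n : ℕ) : Prop :=
  (∀ ℓ : ℕ, HasFockMatrix e (kraus e T n ℓ) fun m k => (T m ℓ k n : ℂ)) ∧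
    ∀ ψ : H, HasSum (fun ℓ : ℕ => ‖kraus e T n ℓ ψ‖ ^ 2) (‖ψ‖ ^ 2)

end Mode

/-! ### The three families of photon-added Gaussian channels -/

/-- Fock matrix elements `⟨m₁, m₂| U |n₁, n₂⟩` of the two-mode squeezer with parameter `κ ≥ 1`.
All natural-number subtractions are exact in the range of summation. -/
def amplifierMatrix (κ : ℝ) (m₁ m₂ n₁ n₂ : ℕ) : ℝ :=
  κ⁻¹ * √((n₁.factorial * m₂.factorial : ℝ) / (m₁.factorial * n₂.factorial)) *
    ∑ r ∈ Finset.range (n₂ + 1), ∑ j ∈ Finset.range (m₁ + 1),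
      if n₁ = r + j ∧ m₂ = n₂ + m₁ - r - j then
        (n₂.choose r : ℝ) * (m₁.choose j : ℝ) * (-1) ^ r *
          κ⁻¹ ^ (n₂ + j - r) * √(1 - κ⁻¹ ^ 2) ^ (m₁ + r - j)
      else 0

/-- Fock matrix elements `⟨m₁, m₂| U |n₁, n₂⟩` of the beamsplitter with parameter `0 ≤ κ ≤ 1`.
All natural-number subtractions are exact in the range of summation. -/
def attenuatorMatrix (κ : ℝ) (m₁ m₂ n₁ n₂ : ℕ) : ℝ :=
  √((m₁.factorial * m₂.factorial : ℝ) / (n₁.factorial * n₂.factorial)) *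
    ∑ r ∈ Finset.range (n₁ + 1), ∑ j ∈ Finset.range (n₂ + 1),
      if m₂ = r + j ∧ m₁ = n₁ + n₂ - r - j then
        (n₁.choose r : ℝ) * (n₂.choose j : ℝ) * (-1) ^ (n₂ - j) *
          κ ^ (n₁ - r + j) * √(1 - κ ^ 2) ^ (r + n₂ - j)
      else 0

/-- Fock matrix elements `⟨m₁, m₂| U |n₁, n₂⟩` of the phase-conjugation unitary with parameter
`κ ≥ 0`. The factor `κ / √(1 + κ²)` is `(√(1 + κ⁻²))⁻¹`, written so that it is also right (equal to
`0`) at `κ = 0`. All natural-number subtractions are exact in the range of summation. -/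
def conjugatorMatrix (κ : ℝ) (m₁ m₂ n₁ n₂ : ℕ) : ℝ :=
  (√(1 + κ ^ 2))⁻¹ * √((n₂.factorial * m₂.factorial : ℝ) / (m₁.factorial * n₁.factorial)) *
    ∑ r ∈ Finset.range (m₁ + 1), ∑ j ∈ Finset.range (n₁ + 1),
      if n₂ = r + j ∧ m₂ = n₁ + m₁ - r - j then
        (m₁.choose r : ℝ) * (n₁.choose j : ℝ) * (√(1 + κ ^ 2))⁻¹ ^ (n₁ + r - j) *
          (-1) ^ j * (κ / √(1 + κ ^ 2)) ^ (m₁ - r + j)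
      else 0

/-- The photon-added amplifier channel `𝒜(κ; n)`, `κ ≥ 1`. -/
def amplifier {H : Type*} [NormedAddCommGroup H] [InnerProductSpace ℂ H] [CompleteSpace H]
    (e : HilbertBasis ℕ ℂ H) (κ : ℝ) (n : ℕ) : (H →L[ℂ] H) → (H →L[ℂ] H) :=
  photonAddedChannel e (amplifierMatrix κ) n

/-- The photon-added attenuator (beamsplitter) channel `ℬ(κ; n)`, `0 ≤ κ ≤ 1`. -/
def attenuator {H : Type*} [NormedAddCommGroup H] [InnerProductSpace ℂ H] [CompleteSpace H]
    (e : HilbertBasis ℕ ℂ H) (κ : ℝ) (n : ℕ) : (H →L[ℂ] H) → (H →L[ℂ] H) :=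
  photonAddedChannel e (attenuatorMatrix κ) n

/-- The photon-added phase-conjugation channel `𝒞(κ; n)`, `κ ≥ 0`. -/
def conjugator {H : Type*} [NormedAddCommGroup H] [InnerProductSpace ℂ H] [CompleteSpace H]
    (e : HilbertBasis ℕ ℂ H) (κ : ℝ) (n : ℕ) : (H →L[ℂ] H) → (H →L[ℂ] H) :=
  photonAddedChannel e (conjugatorMatrix κ) n

end PhotonAdded

end

/-! Complementary channels have equal minimum output entropy. For a unit vector `u` let `W` be the
operator with `W† e_l = K_l u`. The output on the pure state `u` is `W†W`, while `WW†` is, up to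
complex conjugation, what the environment receives. These two operators have the same entropy
(`vonNeumannEntropy_mul_adjoint_comm`). Entropy is concave, so a lower bound valid on pure inputs
holds on all inputs (`le_vonNeumannEntropy_krausMap`), and the two channels have the same infimum.

What makes the two channels complementary is an identity of Fock matrices: exchanging the two output
indices turns `𝒜(κ; n)` into `𝒞(√(κ² - 1); n)` exactly, and `ℬ(κ; n)` into `ℬ(√(1 - κ²); n)` up to
the sign `(-1) ^ n` (`conjugatorMatrix_eq_amplifierMatrix`, `attenuatorMatrix_swap`). Both are
symmetries of the coefficients of a product of powers of two linear forms. The entries are real, so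
the remaining complex conjugation can be absorbed by conjugating the input vector
(`vonNeumannEntropy_krausMap_conjVector`).

That the Kraus operators exist and satisfy `∑ K_l† K_l = 1` reduces to normalized columns:
photon-number conservation gives distinct columns disjoint supports, so orthogonality is automatic
(`isKrausFamily_of_hasSum`). The norms are computed by induction on the system photon number, from
the canonical commutation relations of the transformed ladder operators
(`rapidDecay_and_tsum_sq_eq_one`). -/

noncomputable section

namespace PhotonAdded

/-! ### Hilbert–Schmidt sums and quadratic forms -/

section HilbertSchmidt

variable {H : Type*} [NormedAddCommGroup H] [InnerProductSpace ℂ H]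

/-- The real part of the quadratic form `x ↦ ⟨x, A x⟩`. -/
def quadForm (A : H →L[ℂ] H) (x : H) : ℝ := RCLike.re (inner ℂ x (A x))

theorem trace_eq_tsum_quadForm (e : HilbertBasis ℕ ℂ H) (A : H →L[ℂ] H) :
    trace e A = ∑' k, ENNReal.ofReal (quadForm A (e k)) := rfl

theorem quadForm_add (A B : H →L[ℂ] H) (x : H) :
    quadForm (A + B) x = quadForm A x + quadForm B x := by
  simp [quadForm]

theorem quadForm_sub (A B : H →L[ℂ] H) (x : H) :
    quadForm (A - B) x = quadForm A x - quadForm B x := by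
  simp [quadForm]

theorem quadForm_smul (c : ℝ) (A : H →L[ℂ] H) (x : H) :
    quadForm (c • A) x = c * quadForm A x := by
  simp only [quadForm, smul_apply]
  rw [← Complex.coe_smul, inner_smul_right]
  simp

theorem quadForm_sum {ι : Type*} (s : Finset ι) (A : ι → H →L[ℂ] H) (x : H) :
    quadForm (∑ i ∈ s, A i) x = ∑ i ∈ s, quadForm (A i) x := by
  simp [quadForm]

theorem quadForm_one (x : H) : quadForm (1 : H →L[ℂ] H) x = ‖x‖ ^ 2 := by
  simp [quadForm, ← Complex.ofReal_pow]

theorem hasSum_quadForm {ι : Type*} {A : ι → H →L[ℂ] H} {S : H →L[ℂ] H} (h : HasSum A S)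
    (x : H) : HasSum (fun i => quadForm (A i) x) (quadForm S x) := by
  have h1 : HasSum (fun i => A i x) (S x) :=
    h.mapL (ContinuousLinearMap.apply ℂ H x)
  have h2 := h1.mapL (innerSL ℂ x)
  have h3 := h2.mapL Complex.reCLM
  simpa [quadForm] using h3

theorem hasSum_norm_inner_sq {ι : Type*} (f : HilbertBasis ι ℂ H) (x : H) :
    HasSum (fun i => ‖inner ℂ (f i) x‖ ^ 2) (‖x‖ ^ 2) := by
  have h := (f.hasSum_inner_mul_inner x x).mapL Complex.reCLM
  convert h using 1
  · ext i
    rw [← inner_conj_symm x (f i), RCLike.conj_mul]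
    simp [← Complex.ofReal_pow]
  · simp [← Complex.ofReal_pow]

theorem ofReal_norm_sq {E : Type*} [SeminormedAddGroup E] (x : E) :
    ENNReal.ofReal (‖x‖ ^ 2) = ‖x‖ₑ ^ 2 := by
  rw [ENNReal.ofReal_pow (norm_nonneg _), ofReal_norm]

theorem tsum_enorm_inner_sq {ι : Type*} (f : HilbertBasis ι ℂ H) (x : H) :
    ∑' i, ‖inner ℂ (f i) x‖ₑ ^ 2 = ‖x‖ₑ ^ 2 := by
  have h := hasSum_norm_inner_sq f x
  rw [← ofReal_norm_sq, ← h.tsum_eq, ENNReal.ofReal_tsum_of_nonneg (fun _ => by positivity)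
    h.summable]
  simp_rw [ofReal_norm_sq]

theorem tsum_enorm_inner_sq' {ι : Type*} (f : HilbertBasis ι ℂ H) (x : H) :
    ∑' i, ‖inner ℂ x (f i)‖ₑ ^ 2 = ‖x‖ₑ ^ 2 := by
  rw [← tsum_enorm_inner_sq f x]
  refine tsum_congr fun i => ?_
  rw [← ofReal_norm_sq, norm_inner_symm, ofReal_norm_sq]

theorem quadForm_nonneg {A : H →L[ℂ] H} (hA : A.IsPositive) (x : H) : 0 ≤ quadForm A x :=
  hA.re_inner_nonneg_right x

theorem quadForm_mono {A B : H →L[ℂ] H} (h : A ≤ B) (x : H) : quadForm A x ≤ quadForm B x := by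
  have := quadForm_nonneg ((ContinuousLinearMap.le_def A B).1 h) x
  rw [quadForm_sub] at this
  linarith

variable [CompleteSpace H]

open ContinuousLinearMap (adjoint)

/-- By Parseval both sides are the double sum of `|⟨g j, A (f i)⟩|²`. Sums in `[0, ∞]` may be
exchanged freely, so no Hilbert–Schmidt assumption is needed. -/
theorem tsum_enorm_sq_adjoint {ι κ : Type*} (f : HilbertBasis ι ℂ H) (g : HilbertBasis κ ℂ H)
    (A : H →L[ℂ] H) : ∑' i, ‖A (f i)‖ₑ ^ 2 = ∑' j, ‖adjoint A (g j)‖ₑ ^ 2 := by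
  simp_rw [← tsum_enorm_inner_sq g (A _), ← tsum_enorm_inner_sq' f (adjoint A _)]
  rw [ENNReal.tsum_comm]
  simp_rw [ContinuousLinearMap.adjoint_inner_left]

theorem tsum_enorm_sq_eq {ι κ : Type*} (f : HilbertBasis ι ℂ H) (g : HilbertBasis κ ℂ H)
    (A : H →L[ℂ] H) : ∑' i, ‖A (f i)‖ₑ ^ 2 = ∑' j, ‖A (g j)‖ₑ ^ 2 := by
  rw [tsum_enorm_sq_adjoint f f, tsum_enorm_sq_adjoint f g (adjoint A)]
  simp

theorem enorm_apply_sq_le {ι : Type*} (f : HilbertBasis ι ℂ H) (A : H →L[ℂ] H) (x : H) :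
    ‖A x‖ₑ ^ 2 ≤ (∑' i, ‖A (f i)‖ₑ ^ 2) * ‖x‖ₑ ^ 2 := by
  rw [tsum_enorm_sq_adjoint f f, ← tsum_enorm_inner_sq f (A x), ← ENNReal.tsum_mul_right]
  refine ENNReal.tsum_le_tsum fun i => ?_
  rw [← mul_pow, ← ContinuousLinearMap.adjoint_inner_left]
  gcongr
  simp only [enorm_eq_nnnorm]
  exact mod_cast nnnorm_inner_le_nnnorm (𝕜 := ℂ) _ _

theorem norm_sq_le_tsum {ι : Type*} (f : HilbertBasis ι ℂ H) (A : H →L[ℂ] H) :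
    ENNReal.ofReal (‖A‖ ^ 2) ≤ ∑' i, ‖A (f i)‖ₑ ^ 2 := by
  by_cases ht : ∑' i, ‖A (f i)‖ₑ ^ 2 = ∞
  · simp [ht]
  rw [ENNReal.ofReal_le_iff_le_toReal ht]
  set c := (∑' i, ‖A (f i)‖ₑ ^ 2).toReal
  have hc : 0 ≤ c := ENNReal.toReal_nonneg
  have h : ‖A‖ ≤ √c := by
    refine ContinuousLinearMap.opNorm_le_bound _ (Real.sqrt_nonneg _) fun x => ?_
    refine abs_le_of_sq_le_sq' ?_ (by positivity) |>.2
    have h1 := enorm_apply_sq_le f A x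
    rw [← ENNReal.ofReal_toReal ht, ← ofReal_norm_sq, ← ofReal_norm_sq,
      ← ENNReal.ofReal_mul hc, ENNReal.ofReal_le_ofReal_iff (by positivity)] at h1
    rwa [mul_pow, Real.sq_sqrt hc]
  calc ‖A‖ ^ 2 ≤ √c ^ 2 := by gcongr
    _ = c := Real.sq_sqrt hc

theorem quadForm_adjoint_mul_self (A : H →L[ℂ] H) (x : H) :
    quadForm (adjoint A * A) x = ‖A x‖ ^ 2 := by
  simp [quadForm, ContinuousLinearMap.adjoint_inner_right, ← Complex.ofReal_pow]

theorem quadForm_conj (A B : H →L[ℂ] H) (x : H) :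
    quadForm (B * A * adjoint B) x = quadForm A (adjoint B x) := by
  simp [quadForm, ContinuousLinearMap.adjoint_inner_left]

theorem exists_sqrt {A : H →L[ℂ] H} (hA : A.IsPositive) :
    ∃ B : H →L[ℂ] H, B.IsPositive ∧ adjoint B = B ∧ B * B = A ∧
      ∀ C, Commute C A → Commute C B := by
  have h0 : 0 ≤ A := (ContinuousLinearMap.nonneg_iff_isPositive A).2 hA
  have hB := (ContinuousLinearMap.nonneg_iff_isPositive _).1 (CFC.sqrt_nonneg A)
  refine ⟨CFC.sqrt A, hB, hB.isSelfAdjoint.adjoint_eq, CFC.sqrt_mul_sqrt_self A h0, ?_⟩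
  intro C hC
  rw [CFC.sqrt_eq_cfc]
  exact (hC.symm.cfc_nnreal _).symm

/-- With `A = B²` the trace is the Hilbert–Schmidt sum of `B`. Index types are arbitrary so that the
trace can be taken in an eigenbasis. -/
theorem tsum_quadForm_eq {ι κ : Type*} (f : HilbertBasis ι ℂ H) (g : HilbertBasis κ ℂ H)
    {A : H →L[ℂ] H} (hA : A.IsPositive) :
    ∑' i, ENNReal.ofReal (quadForm A (f i)) = ∑' j, ENNReal.ofReal (quadForm A (g j)) := by
  obtain ⟨B, -, hB, rfl, -⟩ := exists_sqrt hA
  have h (x : H) : ENNReal.ofReal (quadForm (B * B) x) = ‖B x‖ₑ ^ 2 := by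
    nth_rw 1 [← hB]
    rw [quadForm_adjoint_mul_self, ofReal_norm_sq]
  simp_rw [h]
  exact tsum_enorm_sq_eq f g B

theorem trace_mul_adjoint_comm (e : HilbertBasis ℕ ℂ H) (A : H →L[ℂ] H) :
    trace e (A * adjoint A) = trace e (adjoint A * A) := by
  have h (B : H →L[ℂ] H) : trace e (adjoint B * B) = ∑' k, ‖B (e k)‖ₑ ^ 2 := by
    simp_rw [trace_eq_tsum_quadForm, quadForm_adjoint_mul_self, ofReal_norm_sq]
  rw [h, tsum_enorm_sq_adjoint e e, ← h]
  simp

end HilbertSchmidt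

/-! ### Entropy of positive operators of trace one -/

section Scalar

theorem negMulLog_le_tangent {x a : ℝ} (hx : 0 ≤ x) (ha : 0 < a) :
    Real.negMulLog x ≤ a + (-(1 + Real.log a)) * x := by
  rcases hx.eq_or_lt with rfl | hx
  · simpa using ha.le
  have h := Real.log_le_sub_one_of_pos (div_pos ha hx)
  rw [Real.log_div ha.ne' hx.ne'] at h
  have h2 := mul_le_mul_of_nonneg_left h hx.le
  have h3 : x * (a / x - 1) = a - x := by field_simp
  rw [h3] at h2
  rw [Real.negMulLog]
  linarith

/-- This is `log y ≤ y - 1` at `y = x / a`. The parabola touches the graph at `x = a`, and a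
quadratic polynomial of an operator is computed directly on an eigenvector. -/
theorem parabola_le_negMulLog {x a : ℝ} (hx : 0 ≤ x) (ha : 0 < a) :
    (1 - Real.log a) * x + (-a⁻¹) * x ^ 2 ≤ Real.negMulLog x := by
  rcases hx.eq_or_lt with rfl | hx
  · simp
  have h := Real.log_le_sub_one_of_pos (div_pos hx ha)
  rw [Real.log_div hx.ne' ha.ne'] at h
  have h2 := mul_le_mul_of_nonneg_left h hx.le
  rw [div_eq_mul_inv] at h2
  rw [Real.negMulLog]
  linarith

/-- Partial sums of the series `∑_{j ≥ 1} x (1 - x) ^ j / j` of `-x log x`. -/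
def negMulLogApprox (N : ℕ) (x : ℝ) : ℝ :=
  ∑ j ∈ Finset.range N, (j + 1 : ℝ)⁻¹ * (x * (1 - x) ^ (j + 1))

theorem hasSum_negMulLog {x : ℝ} (h0 : 0 ≤ x) (h1 : x ≤ 1) :
    HasSum (fun j : ℕ => (j + 1 : ℝ)⁻¹ * (x * (1 - x) ^ (j + 1))) (Real.negMulLog x) := by
  rcases h0.eq_or_lt with rfl | h0
  · simp
  have h := (Real.hasSum_pow_div_log_of_abs_lt_one (x := 1 - x)
    (by rw [abs_lt]; constructor <;> linarith)).mul_left x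
  rw [sub_sub_cancel, mul_neg, ← neg_mul] at h
  refine (congrArg (fun f : ℕ → ℝ => HasSum f (Real.negMulLog x)) (funext fun j => ?_)).mp h
  rw [div_eq_inv_mul]
  ring

theorem negMulLogApprox_le {x : ℝ} (h0 : 0 ≤ x) (h1 : x ≤ 1) (N : ℕ) :
    negMulLogApprox N x ≤ Real.negMulLog x := by
  refine sum_le_hasSum _ (fun j _ => ?_) (hasSum_negMulLog h0 h1)
  have : 0 ≤ 1 - x := by linarith
  positivity

/-- The tail is at most `(N + 1)⁻¹ ∑ x (1 - x) ^ j`, and this geometric series sums to one for `x >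
0`. The bound is uniform in `x`, as is needed to pass it through the functional calculus. -/
theorem negMulLog_le_approx_add {x : ℝ} (h0 : 0 ≤ x) (h1 : x ≤ 1) (N : ℕ) :
    Real.negMulLog x ≤ negMulLogApprox N x + (N + 1 : ℝ)⁻¹ := by
  have hy : 0 ≤ 1 - x := by linarith
  rcases h0.eq_or_lt with rfl | h0
  · have : 0 ≤ negMulLogApprox N 0 := Finset.sum_nonneg fun j _ => by positivity
    rw [Real.negMulLog_zero]
    positivity
  have hs := hasSum_negMulLog h0.le h1
  have ht := (hasSum_nat_add_iff' N).2 hs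
  have hg : HasSum (fun j : ℕ => (N + 1 : ℝ)⁻¹ * (x * (1 - x) ^ j)) (N + 1 : ℝ)⁻¹ := by
    have := ((hasSum_geometric_of_lt_one hy (by linarith)).mul_left x).mul_left (N + 1 : ℝ)⁻¹
    rwa [sub_sub_cancel, mul_inv_cancel₀ h0.ne', mul_one] at this
  have hle := hasSum_le (fun j : ℕ => ?_) ht hg
  · unfold negMulLogApprox
    linarith
  · have e1 : (((j + N : ℕ) : ℝ) + 1)⁻¹ ≤ (N + 1 : ℝ)⁻¹ := by
      apply inv_anti₀ (by positivity)
      push_cast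
      linarith [(Nat.cast_nonneg j : (0 : ℝ) ≤ j)]
    have e2 : (1 - x) ^ (j + N + 1) ≤ (1 - x) ^ j :=
      pow_le_pow_of_le_one hy (by linarith) (by omega)
    gcongr

end Scalar

section Entropy

variable {H : Type*} [NormedAddCommGroup H] [InnerProductSpace ℂ H] [CompleteSpace H]

open ContinuousLinearMap (adjoint)

theorem spectrum_subset_Icc {A : H →L[ℂ] H} (h0 : 0 ≤ A) (h1 : A ≤ 1) :
    ∀ x ∈ spectrum ℝ A, 0 ≤ x ∧ x ≤ 1 := by
  intro x hx
  refine ⟨spectrum_nonneg_of_nonneg h0 hx, ?_⟩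
  have hA : IsSelfAdjoint A := IsSelfAdjoint.of_nonneg h0
  have h1' : A ≤ algebraMap ℝ (H →L[ℂ] H) 1 := by simpa using h1
  exact (le_algebraMap_iff_spectrum_le hA).1 h1' x hx

/-- For `A = B²`, `⟨x, A x⟩ = ‖B x‖²` is at most the Hilbert–Schmidt sum of `B` times `‖x‖²`, and
that sum is the trace of `A`. -/
theorem le_one_of_trace_le_one {e : HilbertBasis ℕ ℂ H} {A : H →L[ℂ] H} (hA : A.IsPositive)
    (h : trace e A ≤ 1) : 0 ≤ A ∧ A ≤ 1 := by
  have h0 := (ContinuousLinearMap.nonneg_iff_isPositive A).2 hA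
  refine ⟨h0, ?_⟩
  obtain ⟨B, -, hB, hBA, -⟩ := exists_sqrt hA
  have hq (x : H) : quadForm A x = ‖B x‖ ^ 2 := by
    rw [← hBA]
    nth_rw 1 [← hB]
    exact quadForm_adjoint_mul_self B x
  rw [trace_eq_tsum_quadForm] at h
  simp_rw [hq, ofReal_norm_sq] at h
  rw [ContinuousLinearMap.le_def, ContinuousLinearMap.isPositive_def']
  refine ⟨(IsSelfAdjoint.one _).sub hA.isSelfAdjoint, fun x => ?_⟩
  rw [ContinuousLinearMap.reApplyInnerSelf_apply, ← inner_re_symm]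
  change 0 ≤ quadForm (1 - A) x
  rw [quadForm_sub, quadForm_one, hq, sub_nonneg,
    ← ENNReal.ofReal_le_ofReal_iff (by positivity), ofReal_norm_sq, ofReal_norm_sq]
  calc ‖B x‖ₑ ^ 2 ≤ _ := enorm_apply_sq_le e B x
    _ ≤ 1 * ‖x‖ₑ ^ 2 := by gcongr
    _ = _ := one_mul _

variable {A : H →L[ℂ] H}

theorem cfc_affine (hA : IsSelfAdjoint A) (a b : ℝ) :
    cfc (fun x : ℝ => a + b * x) A = a • 1 + b • A := by
  rw [cfc_const_add a (fun x => b * x) A, cfc_const_mul b (fun x => x) A, cfc_id' ℝ A,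
    Algebra.algebraMap_eq_smul_one]

theorem cfc_quadratic (hA : IsSelfAdjoint A) (a b : ℝ) :
    cfc (fun x : ℝ => a * x + b * x ^ 2) A = a • A + b • A ^ 2 := by
  rw [cfc_add A (fun x => a * x) (fun x => b * x ^ 2), cfc_const_mul a (fun x => x) A,
    cfc_const_mul b (fun x => x ^ 2) A, cfc_id' ℝ A, cfc_pow_id A 2]

theorem cfc_mul_one_sub_pow (hA : IsSelfAdjoint A) (k : ℕ) :
    cfc (fun x : ℝ => x * (1 - x) ^ k) A = A * (1 - A) ^ k := by
  have h1 : cfc (fun x : ℝ => 1 - x) A = 1 - A := by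
    rw [cfc_sub (fun _ => 1) (fun x => x) A, cfc_const_one ℝ A, cfc_id' ℝ A]
  rw [cfc_mul (fun x => x) (fun x : ℝ => (1 - x) ^ k) A, cfc_id' ℝ A,
    cfc_pow (fun x : ℝ => 1 - x) k A, h1]

theorem cfc_negMulLogApprox (hA : IsSelfAdjoint A) (N : ℕ) :
    cfc (negMulLogApprox N) A =
      ∑ j ∈ Finset.range N, (j + 1 : ℝ)⁻¹ • (A * (1 - A) ^ (j + 1)) := by
  have h : negMulLogApprox N =
      ∑ j ∈ Finset.range N, fun x : ℝ => (j + 1 : ℝ)⁻¹ * (x * (1 - x) ^ (j + 1)) := by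
    ext x
    simp [negMulLogApprox]
  rw [h, cfc_sum (fun (j : ℕ) (x : ℝ) => (j + 1 : ℝ)⁻¹ * (x * (1 - x) ^ (j + 1))) A]
  refine Finset.sum_congr rfl fun j _ => ?_
  rw [cfc_const_mul _ (fun x : ℝ => x * (1 - x) ^ (j + 1)) A, cfc_mul_one_sub_pow hA]

theorem mul_one_sub_pow_nonneg (h0 : 0 ≤ A) (h1 : A ≤ 1) (k : ℕ) : 0 ≤ A * (1 - A) ^ k := by
  rw [← cfc_mul_one_sub_pow (IsSelfAdjoint.of_nonneg h0)]
  refine cfc_nonneg fun x hx => ?_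
  obtain ⟨hx0, hx1⟩ := spectrum_subset_Icc h0 h1 x hx
  have : 0 ≤ 1 - x := by linarith
  positivity

theorem cfc_negMulLog_nonneg (h0 : 0 ≤ A) (h1 : A ≤ 1) : 0 ≤ cfc Real.negMulLog A :=
  cfc_nonneg fun x hx =>
    Real.negMulLog_nonneg (spectrum_subset_Icc h0 h1 x hx).1 (spectrum_subset_Icc h0 h1 x hx).2

theorem quadForm_cfc_negMulLog_le (h0 : 0 ≤ A) {a : ℝ} (ha : 0 < a) (x : H) :
    quadForm (cfc Real.negMulLog A) x ≤ a * ‖x‖ ^ 2 + (-(1 + Real.log a)) * quadForm A x := by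
  have h := cfc_mono (R := ℝ) (a := A) (f := Real.negMulLog)
    (g := fun x => a + (-(1 + Real.log a)) * x)
    (fun x hx => negMulLog_le_tangent (spectrum_nonneg_of_nonneg h0 hx) ha)
    (by fun_prop) (by fun_prop)
  have h2 := quadForm_mono h x
  rwa [cfc_affine (IsSelfAdjoint.of_nonneg h0), quadForm_add, quadForm_smul, quadForm_smul,
    quadForm_one] at h2

theorem negMulLog_le_quadForm_cfc (h0 : 0 ≤ A) (h1 : A ≤ 1) {c : ℝ} (hc : 0 ≤ c) {x : H}
    (hx : ‖x‖ = 1) (hAx : A x = (c : ℂ) • x) :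
    Real.negMulLog c ≤ quadForm (cfc Real.negMulLog A) x := by
  rcases hc.eq_or_lt with rfl | hc
  · rw [Real.negMulLog_zero]
    exact quadForm_nonneg
      ((ContinuousLinearMap.nonneg_iff_isPositive _).1 (cfc_negMulLog_nonneg h0 h1)) x
  have h := cfc_mono (R := ℝ) (a := A) (g := Real.negMulLog)
    (f := fun x => (1 - Real.log c) * x + (-c⁻¹) * x ^ 2)
    (fun x hx => parabola_le_negMulLog (spectrum_nonneg_of_nonneg h0 hx) hc)
    (by fun_prop) (by fun_prop)
  have h2 := quadForm_mono h x
  rw [cfc_quadratic (IsSelfAdjoint.of_nonneg h0), quadForm_add, quadForm_smul, quadForm_smul] at h2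
  have q1 : quadForm A x = c := by
    simp [quadForm, hAx, hx]
  have q2 : quadForm (A ^ 2) x = c ^ 2 := by
    simp [quadForm, pow_two, hAx, hx]
  rw [q1, q2] at h2
  refine le_trans (le_of_eq ?_) h2
  rw [Real.negMulLog]
  field_simp
  ring

theorem hasSum_quadForm_negMulLog (h0 : 0 ≤ A) (h1 : A ≤ 1) (x : H) :
    HasSum (fun j : ℕ => (j + 1 : ℝ)⁻¹ * quadForm (A * (1 - A) ^ (j + 1)) x)
      (quadForm (cfc Real.negMulLog A) x) := by
  have hnn (k : ℕ) : 0 ≤ quadForm (A * (1 - A) ^ k) x := quadForm_nonneg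
    ((ContinuousLinearMap.nonneg_iff_isPositive _).1 (mul_one_sub_pow_nonneg h0 h1 k)) x
  rw [hasSum_iff_tendsto_nat_of_nonneg fun j => mul_nonneg (by positivity) (hnn _)]
  have hA := IsSelfAdjoint.of_nonneg h0
  have hcont (N : ℕ) : Continuous (negMulLogApprox N) := by
    unfold negMulLogApprox
    fun_prop
  have hq (N : ℕ) : ∑ j ∈ Finset.range N, (j + 1 : ℝ)⁻¹ * quadForm (A * (1 - A) ^ (j + 1)) x =
      quadForm (cfc (negMulLogApprox N) A) x := by
    rw [cfc_negMulLogApprox hA, quadForm_sum]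
    simp_rw [quadForm_smul]
  simp_rw [hq]
  have hlow : Filter.Tendsto
      (fun N : ℕ => quadForm (cfc Real.negMulLog A) x - (N + 1 : ℝ)⁻¹ * ‖x‖ ^ 2) Filter.atTop
      (nhds (quadForm (cfc Real.negMulLog A) x)) := by
    have := (tendsto_one_div_add_atTop_nhds_zero_nat (𝕜 := ℝ)).mul_const (‖x‖ ^ 2)
    simpa using this.const_sub (quadForm (cfc Real.negMulLog A) x)
  refine tendsto_of_tendsto_of_tendsto_of_le_of_le hlow tendsto_const_nhds (fun N => ?_)
    (fun N => ?_)
  · have h := cfc_mono (R := ℝ) (a := A) (f := Real.negMulLog)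
      (g := fun x => negMulLogApprox N x + (N + 1 : ℝ)⁻¹)
      (fun x hx => negMulLog_le_approx_add (spectrum_subset_Icc h0 h1 x hx).1
        (spectrum_subset_Icc h0 h1 x hx).2 N) (by fun_prop) (by fun_prop)
    have h2 := quadForm_mono h x
    rw [cfc_add_const _ _ A (by fun_prop), Algebra.algebraMap_eq_smul_one, quadForm_add,
      quadForm_smul, quadForm_one] at h2
    exact sub_le_iff_le_add.2 h2
  · exact quadForm_mono (cfc_mono (R := ℝ) (a := A) (f := negMulLogApprox N)
      (fun x hx => negMulLogApprox_le (spectrum_subset_Icc h0 h1 x hx).1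
        (spectrum_subset_Icc h0 h1 x hx).2 N) (by fun_prop) (by fun_prop)) x

theorem mul_one_sub_pow_comm (W : H →L[ℂ] H) (k : ℕ) :
    W * (1 - adjoint W * W) ^ k = (1 - W * adjoint W) ^ k * W := by
  induction k with
  | zero => simp
  | succ k ih => rw [pow_succ, ← mul_assoc, ih, pow_succ]; noncomm_ring

/-- Let `N` be the square root of `(1 - W†W) ^ k`; it commutes with `W†W`. The two operators are
then `(WN)(WN)†` and `(WN)†(WN)`. -/
theorem trace_mul_one_sub_pow_comm (e : HilbertBasis ℕ ℂ H) {W : H →L[ℂ] H}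
    (h1 : adjoint W * W ≤ 1) (k : ℕ) :
    trace e (W * adjoint W * (1 - W * adjoint W) ^ k) =
      trace e (adjoint W * W * (1 - adjoint W * W) ^ k) := by
  have hM : ((1 - adjoint W * W) ^ k).IsPositive :=
    (ContinuousLinearMap.nonneg_iff_isPositive _).1 (CStarAlgebra.pow_nonneg (sub_nonneg.2 h1) k)
  obtain ⟨N, -, hN, hNM, hcomm⟩ := exists_sqrt hM
  have hc : Commute (adjoint W * W) N :=
    hcomm _ (((Commute.one_right _).sub_right (Commute.refl _)).pow_right k)
  have h2 : W * adjoint W * (1 - W * adjoint W) ^ k = (W * N) * adjoint (W * N) := by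
    have := mul_one_sub_pow_comm (adjoint W) k
    rw [ContinuousLinearMap.adjoint_adjoint] at this
    rw [mul_assoc, this, ← hNM]
    change _ = (W * N) * adjoint (W ∘L N)
    rw [ContinuousLinearMap.adjoint_comp, hN]
    simp only [mul_assoc]
    rfl
  have h3 : adjoint W * W * (1 - adjoint W * W) ^ k = adjoint (W * N) * (W * N) := by
    change _ = adjoint (W ∘L N) * (W * N)
    rw [ContinuousLinearMap.adjoint_comp, hN, ← hNM, ← mul_assoc, hc.eq]
    simp only [mul_assoc]
    rfl
  rw [h2, h3, trace_mul_adjoint_comm]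

/-- All terms of the series of `-x log x` are nonnegative on `[0, 1]`, so trace and series commute
even when the entropy is infinite. This reduces equality of entropies to equality of traces of
polynomials. -/
theorem vonNeumannEntropy_eq_tsum (e : HilbertBasis ℕ ℂ H) (h0 : 0 ≤ A) (h1 : A ≤ 1) :
    vonNeumannEntropy e A =
      ∑' j : ℕ, ENNReal.ofReal (j + 1 : ℝ)⁻¹ * trace e (A * (1 - A) ^ (j + 1)) := by
  have hnn (k : ℕ) (x : H) : 0 ≤ quadForm (A * (1 - A) ^ k) x := quadForm_nonneg
    ((ContinuousLinearMap.nonneg_iff_isPositive _).1 (mul_one_sub_pow_nonneg h0 h1 k)) x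
  rw [vonNeumannEntropy]
  simp_rw [trace_eq_tsum_quadForm, ← ENNReal.tsum_mul_left]
  rw [ENNReal.tsum_comm]
  refine tsum_congr fun k => ?_
  have h := hasSum_quadForm_negMulLog h0 h1 (e k)
  rw [← h.tsum_eq, ENNReal.ofReal_tsum_of_nonneg
    (fun j => mul_nonneg (by positivity) (hnn _ _)) h.summable]
  refine tsum_congr fun j => ?_
  rw [ENNReal.ofReal_mul (by positivity)]

theorem vonNeumannEntropy_mul_adjoint_comm (e : HilbertBasis ℕ ℂ H) {W : H →L[ℂ] H}
    (h1 : adjoint W * W ≤ 1) (h2 : W * adjoint W ≤ 1) :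
    vonNeumannEntropy e (W * adjoint W) = vonNeumannEntropy e (adjoint W * W) := by
  have h3 : 0 ≤ W * adjoint W := mul_star_self_nonneg W
  have h4 : 0 ≤ adjoint W * W := star_mul_self_nonneg W
  rw [vonNeumannEntropy_eq_tsum e h3 h2, vonNeumannEntropy_eq_tsum e h4 h1]
  simp_rw [trace_mul_one_sub_pow_comm e h1]

end Entropy

/-! ### Spectral decomposition and concavity of the entropy -/

section Concavity

universe u

variable {H : Type u} [NormedAddCommGroup H] [InnerProductSpace ℂ H]

open ContinuousLinearMap (adjoint)
open InnerProductSpace (rankOne)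

theorem quadForm_rankOne (x y : H) : quadForm (rankOne ℂ x x) y = ‖inner ℂ x y‖ ^ 2 := by
  simp only [quadForm, InnerProductSpace.rankOne_apply, inner_smul_right]
  rw [← inner_conj_symm y x, RCLike.mul_conj]
  norm_cast

theorem isCompactOperator_rankOne (x y : H) : IsCompactOperator (rankOne ℂ x y) := by
  rw [InnerProductSpace.rankOne_def']
  exact (isCompactOperator_of_locallyCompactSpace_rng
    (ContinuousLinearMap.toSpanSingleton ℂ x)).comp_clm (innerSL ℂ y)

variable [CompleteSpace H]

theorem rankOne_map_map_adjoint (C : H →L[ℂ] H) (x y : H) :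
    C * rankOne ℂ x y * adjoint C = rankOne ℂ (C x) (C y) := by
  change (C ∘L rankOne ℂ x y) ∘L adjoint C = _
  rw [InnerProductSpace.comp_rankOne, InnerProductSpace.rankOne_comp]
  simp

theorem hasSum_of_hasSum_quadForm {ι : Type*} {f : ι → ℝ} {b : ℝ} (hf : ∀ i, 0 ≤ f i) (hb : 0 ≤ b)
    (h : ∑' i, ENNReal.ofReal (f i) = ENNReal.ofReal b) : HasSum f b := by
  have h1 : HasSum (fun i => ENNReal.ofReal (f i)) (ENNReal.ofReal b) :=
    h ▸ ENNReal.summable.hasSum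
  have h2 := (ENNReal.hasSum_toReal (f := fun i => ENNReal.ofReal (f i)) (by simp [h]))
  simp only [ENNReal.toReal_ofReal (hf _)] at h2
  have h3 : ∑' i, f i = b := by
    rw [← ENNReal.toReal_ofReal hb, ← h, ENNReal.tsum_toReal_eq (by simp)]
    simp only [ENNReal.toReal_ofReal (hf _)]
  rwa [h3] at h2

/-- A Hilbert–Schmidt operator `B` gives a norm convergent expansion of `B B†`. -/
theorem hasSum_rankOne_mul_adjoint (e : HilbertBasis ℕ ℂ H) {B : H →L[ℂ] H}
    (hB : ∑' k, ‖B (e k)‖ₑ ^ 2 ≠ ∞) :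
    HasSum (fun k => rankOne ℂ (B (e k)) (B (e k))) (B * adjoint B) := by
  have hs : Summable fun k => rankOne ℂ (B (e k)) (B (e k)) := by
    refine Summable.of_norm ?_
    have := ENNReal.summable_toReal hB
    convert this using 2 with k
    simp [pow_two]
  convert hs.hasSum using 1
  ext x
  have h1 := hs.hasSum.mapL (ContinuousLinearMap.apply ℂ H x)
  have h2 := (e.hasSum_repr (adjoint B x)).mapL B
  refine h2.unique ?_
  refine (congrArg (HasSum · _) (funext fun k => ?_)).mp h1
  simp [e.repr_apply_apply, ContinuousLinearMap.adjoint_inner_right]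

theorem isCompactOperator_mul_adjoint (e : HilbertBasis ℕ ℂ H) {B : H →L[ℂ] H}
    (hB : ∑' k, ‖B (e k)‖ₑ ^ 2 ≠ ∞) : IsCompactOperator (B * adjoint B) := by
  have h := hasSum_rankOne_mul_adjoint e hB
  refine isCompactOperator_of_tendsto h (Filter.Eventually.of_forall fun s => ?_)
  induction s using Finset.induction with
  | empty => simpa using isCompactOperator_zero
  | insert a s ha ih =>
    rw [Finset.sum_insert ha]
    exact (isCompactOperator_rankOne _ _).add ih

/-- Hilbert bases of the eigenspaces are glued together. The result is complete because, for a
compact symmetric operator, nothing nonzero is orthogonal to all eigenspaces. -/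
theorem exists_hilbertBasis_eigenvectors {A : H →L[ℂ] H} (hA : A.IsPositive)
    (hc : IsCompactOperator A) :
    ∃ (ι : Type u) (f : HilbertBasis ι ℂ H), ∀ i, A (f i) = (quadForm A (f i) : ℂ) • f i := by
  have hsymm := hA.isSymmetric
  set E : ℂ → Submodule ℂ H := fun μ => Module.End.eigenspace (A : Module.End ℂ H) μ
  have hcl (μ : ℂ) : CompleteSpace (E μ) := by
    have : IsClosed (E μ : Set H) := by
      have : (E μ : Set H) = {x | A x = μ • x} := by
        ext x
        simp [E]
      rw [this]
      exact isClosed_eq A.continuous (continuous_const_smul μ)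
    exact this.completeSpace_coe
  choose w b hb using fun μ => exists_hilbertBasis ℂ (E μ)
  have hon : Orthonormal ℂ fun a : Σ μ, w μ => (b a.1 a.2 : H) :=
    hsymm.orthogonalFamily_eigenspaces.orthonormal_sigma_orthonormal
    (v_family := fun μ => (b μ : w μ → E μ)) fun μ => (b μ).orthonormal
  have hmem (a : Σ μ, w μ) : A (b a.1 a.2 : H) = a.1 • (b a.1 a.2 : H) :=
    Module.End.mem_eigenspace_iff.1 (b a.1 a.2).2
  have hbot : (Submodule.span ℂ (Set.range fun a : Σ μ, w μ => (b a.1 a.2 : H)))ᗮ = ⊥ := by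
    rw [← ContinuousLinearMap.orthogonalComplement_iSup_eigenspaces_eq_bot hc hsymm]
    refine le_antisymm (fun x hx => ?_) (Submodule.orthogonal_le ?_)
    · rw [Submodule.mem_orthogonal] at hx
      rw [← Submodule.iInf_orthogonal, Submodule.mem_iInf]
      intro μ
      rw [Submodule.mem_orthogonal]
      intro u hu
      have h1 := ((b μ).hasSum_repr ⟨u, hu⟩).mapL ((innerSL ℂ x).comp (E μ).subtypeL)
      have h2 : ∀ i, inner ℂ x (b μ i : H) = 0 := fun i => by
        rw [← inner_conj_symm, hx _ (Submodule.subset_span ⟨⟨μ, i⟩, rfl⟩), map_zero]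
      simp only [ContinuousLinearMap.comp_apply, map_smul, Submodule.subtypeL_apply,
        innerSL_apply_apply, h2, smul_zero] at h1
      rw [← inner_conj_symm, ← hasSum_zero.unique h1, map_zero]
    · rw [Submodule.span_le]
      rintro _ ⟨a, rfl⟩
      exact Submodule.mem_iSup_of_mem a.1 (b a.1 a.2).2
  refine ⟨Σ μ, w μ, HilbertBasis.mkOfOrthogonalEqBot hon hbot, fun a => ?_⟩
  rw [HilbertBasis.coe_mkOfOrthogonalEqBot]
  have hn : ‖(b a.1 a.2 : H)‖ = 1 := hon.1 a
  have hq : inner ℂ (b a.1 a.2 : H) (A (b a.1 a.2 : H)) = a.1 := by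
    rw [hmem, inner_smul_right, inner_self_eq_norm_sq_to_K, hn]
    simp
  have hr : (quadForm A (b a.1 a.2 : H) : ℂ) = a.1 := by
    refine Eq.trans ?_ hq
    have h3 := (Complex.nonneg_iff.1 (hA.inner_nonneg_right (b a.1 a.2 : H))).2
    exact Complex.ext (by simp [quadForm]) (by rw [← h3, Complex.ofReal_im])
  change A (b a.1 a.2 : H) = (quadForm A (b a.1 a.2 : H) : ℂ) • (b a.1 a.2 : H)
  rw [hr, hmem]

/-- Jensen's inequality at one eigenvector of the mixture: `-t log t` lies below its tangent at the
eigenvalue `c`, and averaging the tangent over the `τ k` gives `-c log c`. -/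
theorem tsum_mul_quadForm_negMulLog_le {σ : H →L[ℂ] H} {τ : ℕ → H →L[ℂ] H} {p : ℕ → ℝ}
    (hp : ∀ k, 0 ≤ p k) (hp1 : HasSum p 1) (h0 : 0 ≤ σ) (h1 : σ ≤ 1)
    (hτ0 : ∀ k, 0 ≤ τ k) (hτ1 : ∀ k, τ k ≤ 1) {x : H} (hx : ‖x‖ = 1)
    (hsum : HasSum (fun k => p k * quadForm (τ k) x) (quadForm σ x))
    (heig : σ x = (quadForm σ x : ℂ) • x) :
    ∑' k, ENNReal.ofReal (p k) * ENNReal.ofReal (quadForm (cfc Real.negMulLog (τ k)) x) ≤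
      ENNReal.ofReal (quadForm (cfc Real.negMulLog σ) x) := by
  set c := quadForm σ x
  have hc : 0 ≤ c := quadForm_nonneg ((ContinuousLinearMap.nonneg_iff_isPositive _).1 h0) x
  have key {a : ℝ} (ha : 0 < a) :
      ∑' k, ENNReal.ofReal (p k) * ENNReal.ofReal (quadForm (cfc Real.negMulLog (τ k)) x) ≤
        ENNReal.ofReal (a + (-(1 + Real.log a)) * c) := by
    have hg : HasSum (fun k => p k * (a + (-(1 + Real.log a)) * quadForm (τ k) x))
        (a + (-(1 + Real.log a)) * c) := by
      have := (hp1.mul_right a).add (hsum.mul_left (-(1 + Real.log a)))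
      rw [one_mul] at this
      refine (congrArg (HasSum · _) (funext fun k => ?_)).mp this
      ring
    have hle (k : ℕ) : p k * quadForm (cfc Real.negMulLog (τ k)) x ≤
        p k * (a + (-(1 + Real.log a)) * quadForm (τ k) x) := by
      have := quadForm_cfc_negMulLog_le (hτ0 k) ha x
      rw [hx, one_pow, mul_one] at this
      exact mul_le_mul_of_nonneg_left this (hp k)
    have hnn (k : ℕ) : 0 ≤ p k * quadForm (cfc Real.negMulLog (τ k)) x :=
      mul_nonneg (hp k) (quadForm_nonneg ((ContinuousLinearMap.nonneg_iff_isPositive _).1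
        (cfc_negMulLog_nonneg (hτ0 k) (hτ1 k))) x)
    rw [← hg.tsum_eq, ENNReal.ofReal_tsum_of_nonneg (fun k => (hnn k).trans (hle k)) hg.summable]
    refine ENNReal.tsum_le_tsum fun k => ?_
    rw [← ENNReal.ofReal_mul (hp k)]
    exact ENNReal.ofReal_le_ofReal (hle k)
  have hlow := negMulLog_le_quadForm_cfc h0 h1 hc hx heig
  rcases hc.eq_or_lt with hc0 | hc0
  -- At `c = 0` the tangent is vertical. The tangent at a small `a > 0` bounds the sum by `a`, which
  -- is arbitrary.
  · refine le_trans (le_of_forall_gt fun b hb => ?_) zero_le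
    obtain ⟨r, hr0, hrb⟩ := ENNReal.lt_iff_exists_real_btwn.1 hb |>.imp fun r h => h.2
    have hr : 0 < r := by simpa using hr0
    refine (key hr).trans_lt ?_
    rwa [← hc0, mul_zero, add_zero]
  · refine (key hc0).trans (ENNReal.ofReal_le_ofReal ?_)
    rw [Real.negMulLog] at hlow
    linarith

/-- Concavity of the von Neumann entropy, for countable mixtures. -/
theorem tsum_mul_vonNeumannEntropy_le (e : HilbertBasis ℕ ℂ H) {σ : H →L[ℂ] H}
    {τ : ℕ → H →L[ℂ] H} {p : ℕ → ℝ} (hp : ∀ k, 0 ≤ p k) (hp1 : HasSum p 1)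
    (hσ : IsDensityOperator e σ) (hτ : ∀ k, IsDensityOperator e (τ k))
    (hsum : ∀ x, HasSum (fun k => p k * quadForm (τ k) x) (quadForm σ x)) :
    ∑' k, ENNReal.ofReal (p k) * vonNeumannEntropy e (τ k) ≤ vonNeumannEntropy e σ := by
  obtain ⟨h0, h1⟩ := le_one_of_trace_le_one hσ.1 hσ.2.le
  have hτ' k := le_one_of_trace_le_one (hτ k).1 (hτ k).2.le
  have hpos {A : H →L[ℂ] H} (h0 : 0 ≤ A) (h1 : A ≤ 1) : (cfc Real.negMulLog A).IsPositive :=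
    (ContinuousLinearMap.nonneg_iff_isPositive _).1 (cfc_negMulLog_nonneg h0 h1)
  obtain ⟨B, -, hB, hBσ, -⟩ := exists_sqrt hσ.1
  have hcomp : IsCompactOperator σ := by
    have hfin : ∑' k, ‖B (e k)‖ₑ ^ 2 ≠ ∞ := by
      have := hσ.2
      rw [trace_eq_tsum_quadForm, ← hBσ] at this
      nth_rw 1 [← hB] at this
      simp_rw [quadForm_adjoint_mul_self, ofReal_norm_sq] at this
      simp [this]
    have := isCompactOperator_mul_adjoint e hfin
    rwa [hB, hBσ] at this
  obtain ⟨ι, f, hf⟩ := exists_hilbertBasis_eigenvectors hσ.1 hcomp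
  have htr {A : H →L[ℂ] H} (h0 : 0 ≤ A) (h1 : A ≤ 1) : vonNeumannEntropy e A =
      ∑' i, ENNReal.ofReal (quadForm (cfc Real.negMulLog A) (f i)) :=
    tsum_quadForm_eq e f (hpos h0 h1)
  rw [htr h0 h1]
  simp_rw [fun k => htr (hτ' k).1 (hτ' k).2, ← ENNReal.tsum_mul_left]
  rw [ENNReal.tsum_comm]
  exact ENNReal.tsum_le_tsum fun i => tsum_mul_quadForm_negMulLog_le hp hp1 h0 h1
    (fun k => (hτ' k).1) (fun k => (hτ' k).2) (f.orthonormal.1 i) (hsum _) (hf i)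

end Concavity

/-! ### Channels in Kraus form -/

section Kraus

universe u

variable {H : Type u} [NormedAddCommGroup H] [InnerProductSpace ℂ H]

open ContinuousLinearMap (adjoint)
open InnerProductSpace (rankOne)

theorem tsum_enorm_kraus_sq {K : ℕ → H →L[ℂ] H}
    (hK : ∀ ψ, HasSum (fun l => ‖K l ψ‖ ^ 2) (‖ψ‖ ^ 2)) (ψ : H) :
    ∑' l, ‖K l ψ‖ₑ ^ 2 = ‖ψ‖ₑ ^ 2 := by
  rw [← ofReal_norm_sq, ← (hK ψ).tsum_eq,
    ENNReal.ofReal_tsum_of_nonneg (fun _ => by positivity) (hK ψ).summable]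
  simp_rw [ofReal_norm_sq]

theorem isDensityOperator_rankOne (e : HilbertBasis ℕ ℂ H) {x : H} (hx : ‖x‖ = 1) :
    IsDensityOperator e (rankOne ℂ x x) := by
  refine ⟨InnerProductSpace.isPositive_rankOne_self x, ?_⟩
  simp_rw [trace_eq_tsum_quadForm, quadForm_rankOne, ofReal_norm_sq]
  rw [tsum_enorm_inner_sq', ← ofReal_norm_sq, hx]
  simp

/-- The conjugate of a vector with respect to a Hilbert basis. -/
def conjVector (e : HilbertBasis ℕ ℂ H) (x : H) : H := e.repr.symm (star (e.repr x))

theorem inner_conjVector (e : HilbertBasis ℕ ℂ H) (x : H) (k : ℕ) :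
    inner ℂ (e k) (conjVector e x) = starRingEnd ℂ (inner ℂ (e k) x) := by
  simp [conjVector, ← e.repr_apply_apply]

theorem norm_conjVector (e : HilbertBasis ℕ ℂ H) (x : H) : ‖conjVector e x‖ = ‖x‖ := by
  simp [conjVector]

theorem inner_apply_conjVector (e : HilbertBasis ℕ ℂ H) {C : H →L[ℂ] H} {M : ℕ → ℕ → ℝ}
    (hC : HasFockMatrix e C fun m k => (M m k : ℂ)) (m : ℕ) (x : H) :
    inner ℂ (e m) (C (conjVector e x)) = starRingEnd ℂ (inner ℂ (e m) (C x)) := by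
  have h (y : H) : HasSum (fun k => inner ℂ (e k) y * (M m k : ℂ)) (inner ℂ (e m) (C y)) := by
    have := (e.hasSum_repr y).mapL ((innerSL ℂ (e m)).comp C)
    simpa [e.repr_apply_apply, hC m] using this
  refine (h _).unique ?_
  have := (h x).mapL (Complex.conjCLE : ℂ →L[ℝ] ℂ)
  simpa [inner_conjVector] using this

/-- The bound makes the coefficient sequence square summable and the resulting map a contraction. It
serves twice: to form `W` from the vectors `K l u`, and to form a Kraus operator from the rows of
its matrix. -/
theorem exists_inner_eq_of_tsum_le (e : HilbertBasis ℕ ℂ H) {w : ℕ → H}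
    (hw : ∀ x, ∑' l, ‖inner ℂ (w l) x‖ₑ ^ 2 ≤ ‖x‖ₑ ^ 2) :
    ∃ W : H →L[ℂ] H, ∀ l x, inner ℂ (e l) (W x) = inner ℂ (w l) x := by
  have hs (x : H) : Summable fun l => ‖inner ℂ (w l) x‖ ^ 2 := by
    have := ENNReal.summable_toReal (ne_top_of_le_ne_top (by simp) (hw x))
    simpa using this
  have hmem (x : H) : Memℓp (fun l => inner ℂ (w l) x) 2 := by
    refine memℓp_gen ?_
    simpa using hs x
  let L : H →ₗ[ℂ] H :=
    { toFun := fun x => e.repr.symm ⟨fun l => inner ℂ (w l) x, hmem x⟩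
      map_add' := fun x y => by
        rw [← map_add]
        congr 1
        ext l
        exact inner_add_right _ _ _
      map_smul' := fun c x => by
        rw [RingHom.id_apply, ← map_smul]
        congr 1
        ext l
        exact inner_smul_right _ _ _ }
  have hL (l : ℕ) (x : H) : inner ℂ (e l) (L x) = inner ℂ (w l) x := by
    rw [← e.repr_apply_apply]
    simp [L]
  refine ⟨L.mkContinuous 1 fun x => ?_, hL⟩
  rw [one_mul]
  refine abs_le_of_sq_le_sq' ?_ (by positivity) |>.2
  rw [← ENNReal.ofReal_le_ofReal_iff (by positivity), ofReal_norm_sq, ofReal_norm_sq,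
    ← tsum_enorm_inner_sq e (L x)]
  simp_rw [hL]
  exact hw x

variable [CompleteSpace H]

/-- The map `ρ ↦ ∑_l K_l ρ K_l†`. -/
def krausMap (K : ℕ → H →L[ℂ] H) (ρ : H →L[ℂ] H) : H →L[ℂ] H :=
  ∑' l, K l ∘L ρ ∘L adjoint (K l)

theorem krausMap_term (C ρ : H →L[ℂ] H) : C ∘L ρ ∘L adjoint C = C * ρ * adjoint C := rfl

theorem adjoint_mul (A B : H →L[ℂ] H) : adjoint (A * B) = adjoint B * adjoint A :=
  ContinuousLinearMap.adjoint_comp A B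

theorem trace_eq_of_sqrt (e : HilbertBasis ℕ ℂ H) {B : H →L[ℂ] H} (hB : adjoint B = B) :
    trace e (B * B) = ∑' k, ‖B (e k)‖ₑ ^ 2 := by
  nth_rw 1 [← hB]
  simp_rw [trace_eq_tsum_quadForm, quadForm_adjoint_mul_self, ofReal_norm_sq]

variable {K : ℕ → H →L[ℂ] H} {ρ : H →L[ℂ] H} {e : HilbertBasis ℕ ℂ H}

/-- With `ρ = B²` each term is `(K l B)(K l B)†`, whose norm is at most the Hilbert–Schmidt sum of
`K l B`. These sums add up to the trace of `ρ`, so the series converges absolutely. -/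
theorem hasSum_krausMap (hK : ∀ ψ, HasSum (fun l => ‖K l ψ‖ ^ 2) (‖ψ‖ ^ 2))
    (hρ : IsDensityOperator e ρ) :
    HasSum (fun l => K l ∘L ρ ∘L adjoint (K l)) (krausMap K ρ) := by
  refine Summable.hasSum ?_
  obtain ⟨B, -, hB, rfl, -⟩ := exists_sqrt hρ.1
  have htr := trace_eq_of_sqrt e hB
  rw [hρ.2] at htr
  have hterm (l : ℕ) : K l ∘L (B * B) ∘L adjoint (K l) = (K l * B) * star (K l * B) := by
    change _ = (K l * B) * adjoint (K l * B)
    rw [adjoint_mul, hB, krausMap_term]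
    simp only [mul_assoc]
  have hfin : ∑' l, ENNReal.ofReal ‖K l ∘L (B * B) ∘L adjoint (K l)‖ ≠ ∞ := by
    refine ne_top_of_le_ne_top ENNReal.one_ne_top ?_
    calc ∑' l, ENNReal.ofReal ‖K l ∘L (B * B) ∘L adjoint (K l)‖
        ≤ ∑' l, ∑' k, ‖K l (B (e k))‖ₑ ^ 2 := by
          refine ENNReal.tsum_le_tsum fun l => ?_
          rw [hterm, CStarRing.norm_self_mul_star, ← pow_two]
          exact norm_sq_le_tsum e (K l * B)
      _ = 1 := by
          rw [ENNReal.tsum_comm]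
          simp_rw [tsum_enorm_kraus_sq hK]
          exact htr.symm
  refine Summable.of_norm ?_
  simpa using ENNReal.summable_toReal hfin

theorem hasSum_quadForm_krausMap (hK : ∀ ψ, HasSum (fun l => ‖K l ψ‖ ^ 2) (‖ψ‖ ^ 2))
    (hρ : IsDensityOperator e ρ) (x : H) :
    HasSum (fun l => quadForm ρ (adjoint (K l) x)) (quadForm (krausMap K ρ) x) := by
  have h := hasSum_quadForm (hasSum_krausMap hK hρ) x
  simp_rw [krausMap_term, quadForm_conj] at h
  exact h

theorem ofReal_quadForm_krausMap (hK : ∀ ψ, HasSum (fun l => ‖K l ψ‖ ^ 2) (‖ψ‖ ^ 2))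
    (hρ : IsDensityOperator e ρ) (x : H) :
    ENNReal.ofReal (quadForm (krausMap K ρ) x) =
      ∑' l, ENNReal.ofReal (quadForm ρ (adjoint (K l) x)) := by
  have h := hasSum_quadForm_krausMap hK hρ x
  rw [← h.tsum_eq, ENNReal.ofReal_tsum_of_nonneg (fun _ => quadForm_nonneg hρ.1 _) h.summable]

theorem isDensityOperator_krausMap (hK : ∀ ψ, HasSum (fun l => ‖K l ψ‖ ^ 2) (‖ψ‖ ^ 2))
    (hρ : IsDensityOperator e ρ) : IsDensityOperator e (krausMap K ρ) := by
  constructor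
  · rw [← ContinuousLinearMap.nonneg_iff_isPositive]
    exact (hasSum_krausMap hK hρ).nonneg fun l =>
      (ContinuousLinearMap.nonneg_iff_isPositive _).2 (hρ.1.conj_adjoint (K l))
  · rw [trace_eq_tsum_quadForm]
    simp_rw [ofReal_quadForm_krausMap hK hρ]
    rw [ENNReal.tsum_comm]
    obtain ⟨B, -, hB, rfl, -⟩ := exists_sqrt hρ.1
    have htr := trace_eq_of_sqrt e hB
    rw [hρ.2] at htr
    have h (l : ℕ) : ∑' k, ENNReal.ofReal (quadForm (B * B) (adjoint (K l) (e k))) =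
        ∑' k, ‖K l (B (e k))‖ₑ ^ 2 := by
      have h1 := tsum_enorm_sq_adjoint e e (K l * B)
      rw [adjoint_mul, hB] at h1
      nth_rw 1 [← hB]
      simp_rw [quadForm_adjoint_mul_self, ofReal_norm_sq]
      exact h1.symm
    simp_rw [h]
    rw [ENNReal.tsum_comm]
    simp_rw [tsum_enorm_kraus_sq hK]
    exact htr.symm

/-- The minimum output entropy is attained on pure states. -/
theorem le_vonNeumannEntropy_krausMap (hK : ∀ ψ, HasSum (fun l => ‖K l ψ‖ ^ 2) (‖ψ‖ ^ 2))
    {S : ℝ≥0∞} (hS : ∀ u : H, ‖u‖ = 1 → S ≤ vonNeumannEntropy e (krausMap K (rankOne ℂ u u)))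
    (hρ : IsDensityOperator e ρ) : S ≤ vonNeumannEntropy e (krausMap K ρ) := by
  obtain ⟨B, -, hB, hBρ, -⟩ := exists_sqrt hρ.1
  have htr := trace_eq_of_sqrt e hB
  rw [hBρ, hρ.2] at htr
  have hu (k : ℕ) : ∃ u : H, ‖u‖ = 1 ∧ B (e k) = (‖B (e k)‖ : ℂ) • u := by
    by_cases h : B (e k) = 0
    -- The weight `‖B (e k)‖²` vanishes here, so any unit vector will do.
    · exact ⟨e 0, e.orthonormal.1 0, by simp [h]⟩
    · refine ⟨(‖B (e k)‖⁻¹ : ℂ) • B (e k), norm_smul_inv_norm h, ?_⟩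
      rw [smul_smul, mul_inv_cancel₀, one_smul]
      simpa using h
  choose u hu1 hu2 using hu
  have hp1 : HasSum (fun k => ‖B (e k)‖ ^ 2) 1 := by
    refine hasSum_of_hasSum_quadForm (fun _ => by positivity) zero_le_one ?_
    simp_rw [ofReal_norm_sq]
    simpa using htr.symm
  have hden k := isDensityOperator_rankOne e (hu1 k)
  have hle := tsum_mul_vonNeumannEntropy_le e (fun k => sq_nonneg ‖B (e k)‖) hp1
    (isDensityOperator_krausMap hK hρ) (fun k => isDensityOperator_krausMap hK (hden k)) ?_
  · refine le_trans ?_ hle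
    calc S = (∑' k, ENNReal.ofReal (‖B (e k)‖ ^ 2)) * S := by
          simp_rw [ofReal_norm_sq]
          rw [← htr, one_mul]
      _ = ∑' k, ENNReal.ofReal (‖B (e k)‖ ^ 2) * S := ENNReal.tsum_mul_right.symm
      _ ≤ _ := ENNReal.tsum_le_tsum fun k => by gcongr; exact hS _ (hu1 k)
  -- The mixture is `ρ = ∑ |B e_k⟩⟨B e_k|`, tested on each `y = K_l† x`: Parseval gives `∑ |⟨e_k, B
  -- y⟩|² = ‖B y‖² = ⟨y, ρ y⟩`.
  · intro x
    refine hasSum_of_hasSum_quadForm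
      (fun k => mul_nonneg (sq_nonneg _)
        (quadForm_nonneg (isDensityOperator_krausMap hK (hden k)).1 x))
      (quadForm_nonneg (isDensityOperator_krausMap hK hρ).1 x) ?_
    rw [ofReal_quadForm_krausMap hK hρ]
    simp_rw [fun k => ENNReal.ofReal_mul (p := ‖B (e k)‖ ^ 2)
      (q := quadForm (krausMap K (rankOne ℂ (u k) (u k))) x) (sq_nonneg _),
      fun k => ofReal_quadForm_krausMap hK (hden k), ← ENNReal.tsum_mul_left]
    rw [ENNReal.tsum_comm]
    refine tsum_congr fun l => ?_
    set y := adjoint (K l) x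
    have h1 (k : ℕ) : ENNReal.ofReal (‖B (e k)‖ ^ 2) *
        ENNReal.ofReal (quadForm (rankOne ℂ (u k) (u k)) y) = ‖inner ℂ (e k) (B y)‖ₑ ^ 2 := by
      rw [← ENNReal.ofReal_mul (sq_nonneg _), quadForm_rankOne, ← mul_pow, ← ofReal_norm_sq]
      have h2 : inner ℂ (e k) (B y) = (‖B (e k)‖ : ℂ) * inner ℂ (u k) y := by
        nth_rw 1 [← hB]
        rw [ContinuousLinearMap.adjoint_inner_right]
        nth_rw 1 [hu2 k]
        rw [inner_smul_left, Complex.conj_ofReal]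
      rw [h2, norm_mul, Complex.norm_real, norm_norm]
    simp_rw [h1]
    rw [tsum_enorm_inner_sq, ← hBρ, ← ofReal_norm_sq]
    have h3 := quadForm_adjoint_mul_self B y
    rw [hB] at h3
    rw [h3]

theorem exists_krausMap_rankOne (e : HilbertBasis ℕ ℂ H)
    (hK : ∀ ψ, HasSum (fun l => ‖K l ψ‖ ^ 2) (‖ψ‖ ^ 2)) {u : H} (hu : ‖u‖ = 1) :
    ∃ W : H →L[ℂ] H, (∀ l x, inner ℂ (e l) (W x) = inner ℂ (K l u) x) ∧
      krausMap K (rankOne ℂ u u) = adjoint W * W := by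
  obtain ⟨W, hW⟩ := exists_inner_eq_of_tsum_le e (w := fun l => K l u) fun x => by
    calc ∑' l, ‖inner ℂ (K l u) x‖ₑ ^ 2 ≤ ∑' l, ‖K l u‖ₑ ^ 2 * ‖x‖ₑ ^ 2 := by
          refine ENNReal.tsum_le_tsum fun l => ?_
          rw [← mul_pow]
          gcongr
          simp only [enorm_eq_nnnorm]
          exact mod_cast nnnorm_inner_le_nnnorm (𝕜 := ℂ) _ _
      _ = ‖x‖ₑ ^ 2 := by
          rw [ENNReal.tsum_mul_right, tsum_enorm_kraus_sq hK, ← ofReal_norm_sq u, hu]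
          simp
  refine ⟨W, hW, ?_⟩
  have hWe (l : ℕ) : adjoint W (e l) = K l u := by
    refine ext_inner_right ℂ fun x => ?_
    rw [ContinuousLinearMap.adjoint_inner_left, hW]
  have hfin : ∑' l, ‖adjoint W (e l)‖ₑ ^ 2 ≠ ∞ := by
    simp_rw [hWe, tsum_enorm_kraus_sq hK]
    simp
  have h := hasSum_rankOne_mul_adjoint e hfin
  rw [ContinuousLinearMap.adjoint_adjoint] at h
  refine HasSum.unique (hasSum_krausMap hK (isDensityOperator_rankOne e hu)) ?_
  simp_rw [krausMap_term, rankOne_map_map_adjoint, ← hWe]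
  exact h

/-- Complementary channels with real matrix elements have the same output entropies on a pure
state and on its conjugate. -/
theorem vonNeumannEntropy_krausMap_conjVector {K' : ℕ → H →L[ℂ] H} {M M' : ℕ → ℕ → ℕ → ℝ}
    (hK : ∀ ψ, HasSum (fun l => ‖K l ψ‖ ^ 2) (‖ψ‖ ^ 2))
    (hK' : ∀ ψ, HasSum (fun l => ‖K' l ψ‖ ^ 2) (‖ψ‖ ^ 2))
    (hM : ∀ l, HasFockMatrix e (K l) fun m k => (M l m k : ℂ))
    (hM' : ∀ l, HasFockMatrix e (K' l) fun m k => (M' l m k : ℂ))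
    {ε : ℝ} (hε : ε * ε = 1) (hMM : ∀ l m k, M' l m k = ε * M m l k) {u : H} (hu : ‖u‖ = 1) :
    vonNeumannEntropy e (krausMap K' (rankOne ℂ (conjVector e u) (conjVector e u))) =
      vonNeumannEntropy e (krausMap K (rankOne ℂ u u)) := by
  have hv : ‖conjVector e u‖ = 1 := (norm_conjVector e u).trans hu
  obtain ⟨W, hW, hWK⟩ := exists_krausMap_rankOne e hK hu
  obtain ⟨W', hW', hWK'⟩ := exists_krausMap_rankOne e hK' hv
  have hswap (l m : ℕ) : inner ℂ (e m) (K' l u) = (ε : ℂ) * inner ℂ (e l) (K m u) := by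
    have h (C : H →L[ℂ] H) (m : ℕ) :
        HasSum (fun k => inner ℂ (e k) u * inner ℂ (e m) (C (e k))) (inner ℂ (e m) (C u)) := by
      have := (e.hasSum_repr u).mapL ((innerSL ℂ (e m)).comp C)
      simpa [e.repr_apply_apply] using this
    refine (h _ m).unique ?_
    refine (congrArg (HasSum · _) (funext fun k => ?_)).mp ((h (K m) l).mul_left (ε : ℂ))
    have h2 : inner ℂ (e m) (K' l (e k)) = (ε : ℂ) * inner ℂ (e l) (K m (e k)) := by
      refine (hM' l m k).trans (Eq.trans ?_ (congrArg _ (hM m l k).symm))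
      beta_reduce
      rw [hMM]
      exact Complex.ofReal_mul _ _
    rw [h2]
    ring
  -- The matrix of `W` consists of the conjugates of `⟨e_m, K_l u⟩`. Taking the adjoint conjugates
  -- once more, which is why the primed channel must act on the conjugate of `u`.
  have hWW : W' = (ε : ℂ) • adjoint W := by
    have h1 : HasFockMatrix e W' fun l m => inner ℂ (e l) (W' (e m)) := fun _ _ => rfl
    refine h1.unique fun l m => ?_
    beta_reduce
    rw [hW', smul_apply, inner_smul_right,
      ContinuousLinearMap.adjoint_inner_right, ← inner_conj_symm (W (e l)), hW,
      ← inner_conj_symm (K' l (conjVector e u)),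
      inner_apply_conjVector e (hM' l), hswap]
    simp
  have hε' : (ε : ℂ) * (ε : ℂ) = 1 := by exact_mod_cast hε
  have hprod : adjoint W' * W' = W * adjoint W := by
    rw [hWW, map_smulₛₗ, ContinuousLinearMap.adjoint_adjoint, smul_mul_smul_comm]
    simp [hε']
  have h1 := isDensityOperator_krausMap hK (isDensityOperator_rankOne e hu)
  have h2 := isDensityOperator_krausMap hK' (isDensityOperator_rankOne e hv)
  rw [hWK] at h1 ⊢
  rw [hWK', hprod] at h2 ⊢
  exact vonNeumannEntropy_mul_adjoint_comm e (le_one_of_trace_le_one h1.1 h1.2.le).2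
    (le_one_of_trace_le_one h2.1 h2.2.le).2

theorem minOutputEntropy_krausMap_le {K' : ℕ → H →L[ℂ] H} {M M' : ℕ → ℕ → ℕ → ℝ}
    (hK : ∀ ψ, HasSum (fun l => ‖K l ψ‖ ^ 2) (‖ψ‖ ^ 2))
    (hK' : ∀ ψ, HasSum (fun l => ‖K' l ψ‖ ^ 2) (‖ψ‖ ^ 2))
    (hM : ∀ l, HasFockMatrix e (K l) fun m k => (M l m k : ℂ))
    (hM' : ∀ l, HasFockMatrix e (K' l) fun m k => (M' l m k : ℂ))
    {ε : ℝ} (hε : ε * ε = 1) (hMM : ∀ l m k, M' l m k = ε * M m l k) :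
    minOutputEntropy e (krausMap K') ≤ minOutputEntropy e (krausMap K) := by
  refine le_iInf₂ fun ρ hρ => le_vonNeumannEntropy_krausMap hK (fun u hu => ?_) hρ
  rw [← vonNeumannEntropy_krausMap_conjVector hK hK' hM hM' hε hMM hu]
  exact iInf₂_le _ (isDensityOperator_rankOne e ((norm_conjVector e u).trans hu))

/-- Complementary photon-added channels have the same minimum output entropy. -/
theorem minOutputEntropy_eq_of_complementary {T T' : ℕ → ℕ → ℕ → ℕ → ℝ} {n : ℕ}
    (hT : IsKrausFamily e T n) (hT' : IsKrausFamily e T' n) {ε : ℝ} (hε : ε * ε = 1)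
    (hTT : ∀ m l k, T' m l k n = ε * T l m k n) :
    minOutputEntropy e (photonAddedChannel e T n) =
      minOutputEntropy e (photonAddedChannel e T' n) := by
  refine le_antisymm (minOutputEntropy_krausMap_le hT'.2 hT.2 hT'.1 hT.1 hε fun l m k => ?_)
    (minOutputEntropy_krausMap_le hT.2 hT'.2 hT.1 hT'.1 hε fun l m k => hTT m l k)
  rw [hTT, ← mul_assoc, hε, one_mul]

end Kraus

/-! ### Kraus families from normalized columns -/

section KrausFamily

variable {H : Type*} [NormedAddCommGroup H] [InnerProductSpace ℂ H]

theorem exists_vector_of_row (e : HilbertBasis ℕ ℂ H) {t : ℕ → ℝ}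
    (ht : ∀ k k', t k ≠ 0 → t k' ≠ 0 → k = k') :
    ∃ w : H, (∀ k, inner ℂ w (e k) = (t k : ℂ)) ∧
      ∀ x, ‖inner ℂ w x‖ₑ ^ 2 = ∑' k, ENNReal.ofReal (t k ^ 2) * ‖inner ℂ (e k) x‖ₑ ^ 2 := by
  by_cases h : ∃ k, t k ≠ 0
  · obtain ⟨a, ha⟩ := h
    have h0 (k : ℕ) (hk : k ≠ a) : t k = 0 := by
      by_contra h
      exact hk (ht k a h ha)
    refine ⟨(t a : ℂ) • e a, fun k => ?_, fun x => ?_⟩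
    · rw [inner_smul_left, Complex.conj_ofReal]
      by_cases hk : k = a
      · subst hk
        rw [inner_self_eq_norm_sq_to_K, e.orthonormal.1]
        simp
      · rw [e.orthonormal.2 (Ne.symm hk), h0 k hk]
        simp
    · rw [tsum_eq_single a fun k hk => by simp [h0 k hk], inner_smul_left, Complex.conj_ofReal,
        ← ofReal_norm_sq, ← ofReal_norm_sq, ← ENNReal.ofReal_mul (sq_nonneg _), norm_mul, mul_pow,
        Complex.norm_real, Real.norm_eq_abs, sq_abs]
  · push Not at h
    exact ⟨0, fun k => by simp [h], fun x => by simp [h]⟩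

/-- Each pair of output indices is reached from at most one input `k`. Hence `|⟨w m l, x⟩|²` has no
cross terms and `∑ ‖K_l ψ‖²` splits over `k` into column norms. -/
theorem isKrausFamily_of_hasSum (e : HilbertBasis ℕ ℂ H) {T : ℕ → ℕ → ℕ → ℕ → ℝ} {n : ℕ}
    (hrow : ∀ m l k k', T m l k n ≠ 0 → T m l k' n ≠ 0 → k = k')
    (hnorm : ∀ k, HasSum (fun p : ℕ × ℕ => T p.1 p.2 k n ^ 2) 1) : IsKrausFamily e T n := by
  choose w hw1 hw2 using fun m l => exists_vector_of_row e (hrow m l)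
  have hcol (k : ℕ) : ∑' l, ∑' m, ENNReal.ofReal (T m l k n ^ 2) = 1 := by
    rw [ENNReal.tsum_comm, ← ENNReal.tsum_prod (f := fun m l => ENNReal.ofReal (T m l k n ^ 2)),
      ← ENNReal.ofReal_tsum_of_nonneg (f := fun p : ℕ × ℕ => T p.1 p.2 k n ^ 2)
        (fun _ => sq_nonneg _) (hnorm k).summable, (hnorm k).tsum_eq, ENNReal.ofReal_one]
  have hsum (l : ℕ) (x : H) : ∑' m, ‖inner ℂ (w m l) x‖ₑ ^ 2 =
      ∑' k, (∑' m, ENNReal.ofReal (T m l k n ^ 2)) * ‖inner ℂ (e k) x‖ₑ ^ 2 := by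
    simp_rw [hw2]
    rw [ENNReal.tsum_comm]
    simp_rw [ENNReal.tsum_mul_right]
  have hex (l : ℕ) : ∃ A : H →L[ℂ] H, ∀ m x, inner ℂ (e m) (A x) = inner ℂ (w m l) x := by
    refine exists_inner_eq_of_tsum_le e fun x => ?_
    rw [hsum, ← tsum_enorm_inner_sq e x]
    refine ENNReal.tsum_le_tsum fun k => ?_
    conv_rhs => rw [← one_mul (‖inner ℂ (e k) x‖ₑ ^ 2), ← hcol k]
    exact mul_le_mul_left (ENNReal.le_tsum (f := fun l => ∑' m, ENNReal.ofReal (T m l k n ^ 2)) l) _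
  choose A hA using hex
  have hAM (l : ℕ) : HasFockMatrix e (A l) fun m k => (T m l k n : ℂ) := fun m k => by
    rw [hA, hw1]
  have hM (l : ℕ) : HasFockMatrix e (kraus e T n l) fun m k => (T m l k n : ℂ) := by
    rw [kraus, ofFockMatrix, dif_pos ⟨A l, hAM l⟩]
    exact Exists.choose_spec (⟨A l, hAM l⟩ : ∃ A : H →L[ℂ] H, HasFockMatrix e A _)
  refine ⟨hM, fun ψ => hasSum_of_hasSum_quadForm (fun _ => by positivity) (by positivity) ?_⟩
  simp_rw [fun l => (hM l).unique (hAM l), ofReal_norm_sq]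
  simp_rw [← tsum_enorm_inner_sq e (A _ _), hA, hsum]
  rw [ENNReal.tsum_comm]
  simp_rw [ENNReal.tsum_mul_right, hcol, one_mul]
  exact tsum_enorm_inner_sq e ψ

end KrausFamily

/-! ### Creation and annihilation operators on two-mode amplitudes -/

section Ladder

/-- Amplitudes that decay faster than every polynomial in the photon numbers, in mean square. -/
def RapidDecay (f : ℕ × ℕ → ℝ) : Prop :=
  ∀ q : ℕ, Summable fun p : ℕ × ℕ => ((p.1 : ℝ) + p.2 + 1) ^ q * f p ^ 2

/-- Creation operator of the first mode. -/
def create₁ (f : ℕ × ℕ → ℝ) (p : ℕ × ℕ) : ℝ := √p.1 * f (p.1 - 1, p.2)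

/-- Annihilation operator of the first mode. -/
def annihilate₁ (f : ℕ × ℕ → ℝ) (p : ℕ × ℕ) : ℝ := √(p.1 + 1) * f (p.1 + 1, p.2)

/-- Creation operator of the second mode. -/
def create₂ (f : ℕ × ℕ → ℝ) (p : ℕ × ℕ) : ℝ := √p.2 * f (p.1, p.2 - 1)

/-- Annihilation operator of the second mode. -/
def annihilate₂ (f : ℕ × ℕ → ℝ) (p : ℕ × ℕ) : ℝ := √(p.2 + 1) * f (p.1, p.2 + 1)

theorem injective_shift₁ : Function.Injective fun p : ℕ × ℕ => (p.1 + 1, p.2) := by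
  rintro ⟨a, b⟩ ⟨c, d⟩ h
  simpa using h

theorem RapidDecay.swap {f : ℕ × ℕ → ℝ} (hf : RapidDecay f) : RapidDecay (f ∘ Prod.swap) := by
  intro q
  refine ((Equiv.prodComm ℕ ℕ).summable_iff.2 (hf q)).congr fun p => ?_
  simp [add_comm (p.1 : ℝ)]

theorem create₂_eq (f : ℕ × ℕ → ℝ) :
    create₂ f = create₁ (f ∘ Prod.swap) ∘ Prod.swap := by
  ext p
  simp [create₁, create₂]

theorem annihilate₂_eq (f : ℕ × ℕ → ℝ) :
    annihilate₂ f = annihilate₁ (f ∘ Prod.swap) ∘ Prod.swap := by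
  ext p
  simp [annihilate₁, annihilate₂]

/-- A sum over the first index may start at one when the terms at zero vanish. -/
theorem hasSum_shift₁ {f : ℕ × ℕ → ℝ} {a : ℝ} (h0 : ∀ m, f (0, m) = 0) :
    HasSum (fun p : ℕ × ℕ => f (p.1 + 1, p.2)) a ↔ HasSum f a := by
  refine injective_shift₁.hasSum_iff (f := f) ?_
  rintro ⟨m, k⟩ hx
  cases m with
  | zero => exact h0 k
  | succ m => exact absurd ⟨(m, k), rfl⟩ hx

theorem RapidDecay.create₁ {f : ℕ × ℕ → ℝ} (hf : RapidDecay f) : RapidDecay (create₁ f) := by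
  intro q
  have h : Summable fun p : ℕ × ℕ =>
      (((p.1 + 1 : ℕ) : ℝ) + p.2 + 1) ^ q * PhotonAdded.create₁ f (p.1 + 1, p.2) ^ 2 := by
    refine Summable.of_nonneg_of_le (fun p => by positivity) (fun p => ?_)
      ((hf (q + 1)).mul_left (2 ^ q))
    rw [PhotonAdded.create₁, mul_pow, Real.sq_sqrt (by positivity)]
    have h1 : (((p.1 + 1 : ℕ) : ℝ) + p.2 + 1) ^ q ≤ 2 ^ q * ((p.1 : ℝ) + p.2 + 1) ^ q := by
      rw [← mul_pow]
      gcongr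
      push_cast
      linarith [(Nat.cast_nonneg p.1 : (0 : ℝ) ≤ p.1), (Nat.cast_nonneg p.2 : (0 : ℝ) ≤ p.2)]
    have h2 : ((p.1 + 1 : ℕ) : ℝ) ≤ (p.1 : ℝ) + p.2 + 1 := by
      push_cast
      linarith [(Nat.cast_nonneg p.2 : (0 : ℝ) ≤ p.2)]
    calc _ ≤ 2 ^ q * ((p.1 : ℝ) + p.2 + 1) ^ q * (((p.1 : ℝ) + p.2 + 1) * f p ^ 2) := by
          simp only [Nat.add_sub_cancel]
          gcongr
      _ = _ := by ring
  -- Terms with no photon in the first mode vanish because of the factor `√0`, so the truncated `p.1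
  -- - 1` does no harm.
  exact ((hasSum_shift₁
    (f := fun p => ((p.1 : ℝ) + p.2 + 1) ^ q * PhotonAdded.create₁ f p ^ 2)
    fun m => by simp [PhotonAdded.create₁]).1 h.hasSum).summable

theorem RapidDecay.annihilate₁ {f : ℕ × ℕ → ℝ} (hf : RapidDecay f) :
    RapidDecay (annihilate₁ f) := by
  intro q
  refine Summable.of_nonneg_of_le (fun p => by positivity) (fun p => ?_)
    ((hf (q + 1)).comp_injective injective_shift₁)
  rw [PhotonAdded.annihilate₁, mul_pow, Real.sq_sqrt (by positivity)]
  have h2 : (p.1 : ℝ) + 1 ≤ ((p.1 + 1 : ℕ) : ℝ) + p.2 + 1 := by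
    push_cast
    linarith [(Nat.cast_nonneg p.2 : (0 : ℝ) ≤ p.2)]
  have h1 : (p.1 : ℝ) + p.2 + 1 ≤ ((p.1 + 1 : ℕ) : ℝ) + p.2 + 1 := by
    push_cast
    linarith
  calc _ ≤ (((p.1 + 1 : ℕ) : ℝ) + p.2 + 1) ^ q *
        ((((p.1 + 1 : ℕ) : ℝ) + p.2 + 1) * f (p.1 + 1, p.2) ^ 2) := by gcongr
    _ = _ := by simp only [Function.comp]; ring

theorem RapidDecay.create₂ {f : ℕ × ℕ → ℝ} (hf : RapidDecay f) : RapidDecay (create₂ f) := by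
  rw [create₂_eq]
  exact hf.swap.create₁.swap

theorem RapidDecay.annihilate₂ {f : ℕ × ℕ → ℝ} (hf : RapidDecay f) :
    RapidDecay (annihilate₂ f) := by
  rw [annihilate₂_eq]
  exact hf.swap.annihilate₁.swap

theorem RapidDecay.linear_comb {f g : ℕ × ℕ → ℝ} (hf : RapidDecay f) (hg : RapidDecay g)
    (a b : ℝ) : RapidDecay fun p => a * f p + b * g p := by
  intro q
  refine Summable.of_nonneg_of_le (fun p => by positivity) (fun p => ?_)
    (((hf q).mul_left (2 * a ^ 2)).add ((hg q).mul_left (2 * b ^ 2)))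
  have h : (a * f p + b * g p) ^ 2 ≤ 2 * a ^ 2 * f p ^ 2 + 2 * b ^ 2 * g p ^ 2 := by
    nlinarith [sq_nonneg (a * f p - b * g p)]
  calc _ ≤ ((p.1 : ℝ) + p.2 + 1) ^ q * (2 * a ^ 2 * f p ^ 2 + 2 * b ^ 2 * g p ^ 2) := by gcongr
    _ = _ := by ring

theorem RapidDecay.summable_mul {f g : ℕ × ℕ → ℝ} (hf : RapidDecay f) (hg : RapidDecay g) :
    Summable fun p => f p * g p := by
  refine Summable.of_norm_bounded ((hf 0).add (hg 0)) fun p => ?_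
  rw [Real.norm_eq_abs, pow_zero, one_mul, one_mul, abs_le]
  constructor <;> nlinarith [sq_nonneg (f p + g p), sq_nonneg (f p - g p)]

theorem tsum_create₁_mul {f g : ℕ × ℕ → ℝ} (hf : RapidDecay f) (hg : RapidDecay g) :
    ∑' p, create₁ f p * g p = ∑' p, f p * annihilate₁ g p := by
  refine HasSum.tsum_eq ((hasSum_shift₁ fun m => by simp [create₁]).1 ?_)
  refine (congrArg (HasSum · _) (funext fun p => ?_)).mp (hf.summable_mul hg.annihilate₁).hasSum
  simp only [create₁, annihilate₁, Nat.add_sub_cancel]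
  push_cast
  ring

theorem tsum_swap (f : ℕ × ℕ → ℝ) : ∑' p : ℕ × ℕ, f p.swap = ∑' p, f p :=
  (Equiv.prodComm ℕ ℕ).tsum_eq f

theorem tsum_create₂_mul {f g : ℕ × ℕ → ℝ} (hf : RapidDecay f) (hg : RapidDecay g) :
    ∑' p, create₂ f p * g p = ∑' p, f p * annihilate₂ g p := by
  have h := tsum_create₁_mul hf.swap hg.swap
  rw [← tsum_swap, ← tsum_swap (fun p => _ * annihilate₁ _ p)] at h
  simpa [create₂_eq, annihilate₂_eq] using h

theorem annihilate₁_create₁ (f : ℕ × ℕ → ℝ) (p : ℕ × ℕ) :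
    annihilate₁ (create₁ f) p = create₁ (annihilate₁ f) p + f p := by
  obtain ⟨m, k⟩ := p
  simp only [annihilate₁, create₁, Nat.add_sub_cancel]
  have h : √((m : ℝ) + 1) * √((m : ℝ) + 1) = m + 1 := Real.mul_self_sqrt (by positivity)
  cases m with
  | zero => simp
  | succ m =>
    have h' : √((m : ℝ) + 1) * √((m : ℝ) + 1) = m + 1 := Real.mul_self_sqrt (by positivity)
    push_cast at h ⊢
    rw [← mul_assoc, ← mul_assoc, h, h']
    ring

theorem annihilate₂_create₂ (f : ℕ × ℕ → ℝ) (p : ℕ × ℕ) :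
    annihilate₂ (create₂ f) p = create₂ (annihilate₂ f) p + f p := by
  have h := annihilate₁_create₁ (f ∘ Prod.swap) p.swap
  simpa [create₂_eq, annihilate₂_eq, Function.comp_assoc] using h

variable {f : ℕ × ℕ → ℝ}

theorem tsum_create₁_sq (hf : RapidDecay f) : ∑' p, create₁ f p * create₁ f p =
    ∑' p, annihilate₁ f p * annihilate₁ f p + ∑' p, f p * f p := by
  rw [tsum_create₁_mul hf hf.create₁, ← Summable.tsum_add
    (hf.annihilate₁.summable_mul hf.annihilate₁) (hf.summable_mul hf)]
  simp_rw [annihilate₁_create₁, mul_add]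
  rw [Summable.tsum_add (hf.summable_mul hf.annihilate₁.create₁) (hf.summable_mul hf),
    Summable.tsum_add (hf.annihilate₁.summable_mul hf.annihilate₁) (hf.summable_mul hf)]
  congr 1
  simp_rw [fun p => mul_comm (f p) (create₁ (annihilate₁ f) p)]
  exact tsum_create₁_mul hf.annihilate₁ hf

theorem tsum_create₂_sq (hf : RapidDecay f) : ∑' p, create₂ f p * create₂ f p =
    ∑' p, annihilate₂ f p * annihilate₂ f p + ∑' p, f p * f p := by
  rw [tsum_create₂_mul hf hf.create₂]
  simp_rw [annihilate₂_create₂, mul_add]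
  rw [Summable.tsum_add (hf.summable_mul hf.annihilate₂.create₂) (hf.summable_mul hf)]
  congr 1
  simp_rw [fun p => mul_comm (f p) (create₂ (annihilate₂ f) p)]
  exact tsum_create₂_mul hf.annihilate₂ hf

theorem tsum_linear_comb_sq {g h : ℕ × ℕ → ℝ} (hg : RapidDecay g) (hh : RapidDecay h) (a b : ℝ) :
    ∑' p, (a * g p + b * h p) ^ 2 =
      a ^ 2 * ∑' p, g p * g p + b ^ 2 * ∑' p, h p * h p + 2 * (a * b) * ∑' p, g p * h p := by
  rw [← tsum_mul_left, ← tsum_mul_left, ← tsum_mul_left,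
    ← Summable.tsum_add ((hg.summable_mul hg).mul_left _) ((hh.summable_mul hh).mul_left _),
    ← Summable.tsum_add (((hg.summable_mul hg).mul_left _).add ((hh.summable_mul hh).mul_left _))
      ((hg.summable_mul hh).mul_left _)]
  exact tsum_congr fun p => by ring

/-- The commutation relation `[A, A†] = a² - b²` for `A† = a a₁† + b a₂`. -/
theorem tsum_squeezed_create_sq (hf : RapidDecay f) {a b : ℝ} (hab : a ^ 2 - b ^ 2 = 1) :
    ∑' p, (a * create₁ f p + b * annihilate₂ f p) ^ 2 =
      ∑' p, (a * annihilate₁ f p + b * create₂ f p) ^ 2 + ∑' p, f p ^ 2 := by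
  -- Moving each creation operator to the other side leaves `f` paired with a product of both
  -- annihilation operators, which commute.
  have hcross : ∑' p, create₁ f p * annihilate₂ f p = ∑' p, annihilate₁ f p * create₂ f p := by
    rw [tsum_create₁_mul hf hf.annihilate₂]
    simp_rw [fun p => mul_comm (annihilate₁ f p) (create₂ f p)]
    rw [tsum_create₂_mul hf hf.annihilate₁]
    refine tsum_congr fun p => ?_
    simp only [annihilate₁, annihilate₂]
    ring
  rw [tsum_linear_comb_sq hf.create₁ hf.annihilate₂, tsum_linear_comb_sq hf.annihilate₁ hf.create₂,
    hcross, tsum_create₁_sq hf, tsum_create₂_sq hf]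
  simp_rw [pow_two (f _)]
  linear_combination (∑' p, f p * f p) * hab

/-- The commutation relation `[A, A†] = a² + b²` for `A† = a a₁† + b a₂†`. -/
theorem tsum_rotated_create_sq (hf : RapidDecay f) {a b : ℝ} (hab : a ^ 2 + b ^ 2 = 1) :
    ∑' p, (a * create₁ f p + b * create₂ f p) ^ 2 =
      ∑' p, (a * annihilate₁ f p + b * annihilate₂ f p) ^ 2 + ∑' p, f p ^ 2 := by
  have hcross : ∑' p, create₁ f p * create₂ f p = ∑' p, annihilate₁ f p * annihilate₂ f p := by
    rw [tsum_create₁_mul hf hf.create₂]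
    refine Eq.trans (tsum_congr fun p => ?_) (tsum_create₂_mul hf.annihilate₁ hf)
    simp only [annihilate₁, create₂]
    ring
  rw [tsum_linear_comb_sq hf.create₁ hf.create₂, tsum_linear_comb_sq hf.annihilate₁ hf.annihilate₂,
    hcross, tsum_create₁_sq hf, tsum_create₂_sq hf]
  simp_rw [pow_two (f _)]
  linear_combination (∑' p, f p * f p) * hab

end Ladder

/-! ### Products of powers of linear forms -/

section LinearForms

open Polynomial

/-- The `k`-th coefficient of `(a + b X) ^ m * (c + d X) ^ n`. -/
def linCoeff (a b c d : ℝ) (m n k : ℕ) : ℝ :=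
  ((C a + C b * X) ^ m * (C c + C d * X) ^ n).coeff k

variable {a b c d : ℝ}

theorem linear_pow_eq_sum (a b : ℝ) (n : ℕ) : (C a + C b * X) ^ n =
    ∑ r ∈ Finset.range (n + 1), C ((n.choose r : ℝ) * b ^ r * a ^ (n - r)) * X ^ r := by
  rw [add_comm, add_pow]
  refine Finset.sum_congr rfl fun r _ => ?_
  simp only [map_mul, map_pow, mul_pow, map_natCast]
  ring

theorem coeff_eq_linCoeff (a b c d : ℝ) (m n k : ℕ) :
    ((C a + C b * X) ^ m * (C c + C d * X) ^ n).coeff k = linCoeff a b c d m n k := rfl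

theorem linCoeff_eq_sum (a b c d : ℝ) (m n k : ℕ) : linCoeff a b c d m n k =
    ∑ r ∈ Finset.range (m + 1), ∑ j ∈ Finset.range (n + 1), if k = r + j then
      ((m.choose r : ℝ) * b ^ r * a ^ (m - r)) * ((n.choose j : ℝ) * d ^ j * c ^ (n - j))
    else 0 := by
  rw [linCoeff, linear_pow_eq_sum, linear_pow_eq_sum, Finset.sum_mul_sum, finsetSum_coeff]
  refine Finset.sum_congr rfl fun r _ => ?_
  rw [finsetSum_coeff]
  refine Finset.sum_congr rfl fun j _ => ?_
  rw [mul_mul_mul_comm, ← C_mul, ← pow_add, coeff_C_mul, coeff_X_pow]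
  simp

theorem linCoeff_zero_left (a b c d : ℝ) (n k : ℕ) :
    linCoeff a b c d 0 n k = n.choose k * d ^ k * c ^ (n - k) := by
  rw [linCoeff_eq_sum]
  simp only [zero_add, Finset.sum_range_one, Nat.choose_self, pow_zero, Nat.cast_one, one_mul,
    Finset.sum_ite_eq, Finset.mem_range]
  split_ifs with h
  · simp
  · rw [Nat.choose_eq_zero_of_lt (by omega)]
    simp

theorem linCoeff_zero_eq_zero_index (a b c d : ℝ) (m n : ℕ) :
    linCoeff a b c d m n 0 = a ^ m * c ^ n := by
  simp [linCoeff, coeff_zero_eq_eval_zero]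

theorem linCoeff_eq_zero_of_lt {m n k : ℕ} (h : m + n < k) : linCoeff a b c d m n k = 0 := by
  rw [linCoeff_eq_sum]
  refine Finset.sum_eq_zero fun r hr => Finset.sum_eq_zero fun j hj => if_neg ?_
  simp only [Finset.mem_range] at hr hj
  omega

theorem linCoeff_succ_left_zero (m n : ℕ) :
    linCoeff a b c d (m + 1) n 0 = a * linCoeff a b c d m n 0 := by
  simp only [linCoeff_zero_eq_zero_index, pow_succ]
  ring

theorem linCoeff_succ_left_succ (m n k : ℕ) : linCoeff a b c d (m + 1) n (k + 1) =
    a * linCoeff a b c d m n (k + 1) + b * linCoeff a b c d m n k := by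
  have h : (C a + C b * X) ^ (m + 1) * (C c + C d * X) ^ n =
      C a * ((C a + C b * X) ^ m * (C c + C d * X) ^ n) +
        C b * ((C a + C b * X) ^ m * (C c + C d * X) ^ n * X) := by ring
  simp only [linCoeff, h, coeff_add, coeff_C_mul, coeff_mul_X]

theorem derivative_linear_mul (m n : ℕ) :
    (C c + C d * X) * derivative ((C a + C b * X) ^ m * (C c + C d * X) ^ n) =
      C ((m : ℝ) * b) * ((C c + C d * X) * ((C a + C b * X) ^ (m - 1) * (C c + C d * X) ^ n)) +
        C ((n : ℝ) * d) * ((C a + C b * X) ^ m * (C c + C d * X) ^ n) := by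
  have hn : (n : ℝ[X]) * (C c + C d * X) ^ n =
      (n : ℝ[X]) * ((C c + C d * X) * (C c + C d * X) ^ (n - 1)) := by
    cases n with
    | zero => simp
    | succ n => rw [Nat.add_sub_cancel, ← pow_succ']
  simp only [derivative_mul, derivative_pow, derivative_add, derivative_C, derivative_X, zero_add,
    map_mul, map_natCast, mul_one, zero_mul]
  linear_combination (-(C d) * (C a + C b * X) ^ m) * hn

theorem cast_mul_linear_pow (m n : ℕ) :
    (m : ℝ[X]) * ((C a + C b * X) ^ m * (C c + C d * X) ^ n) =
      (m : ℝ[X]) * ((C a + C b * X) * ((C a + C b * X) ^ (m - 1) * (C c + C d * X) ^ n)) := by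
  cases m with
  | zero => simp
  | succ m => rw [Nat.add_sub_cancel, pow_succ']; ring

/-- With `Δ = b c - a d`, the polynomial `P = (a + b X) ^ m * (c + d X) ^ n` satisfies
`(c + d X) P' - d (m + n) P = m Δ (a + b X) ^ (m - 1) * (c + d X) ^ n`. -/
theorem linear_differential_eq (m n : ℕ) :
    (C c + C d * X) * derivative ((C a + C b * X) ^ m * (C c + C d * X) ^ n) -
      C ((m + n : ℝ) * d) * ((C a + C b * X) ^ m * (C c + C d * X) ^ n) =
      C (m * (b * c - a * d)) * ((C a + C b * X) ^ (m - 1) * (C c + C d * X) ^ n) := by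
  rw [derivative_linear_mul]
  simp only [map_mul, map_add, map_sub, map_natCast]
  linear_combination (-(C d)) * cast_mul_linear_pow (a := a) (b := b) (c := c) (d := d) m n

/-- Comparison of coefficients in `linear_differential_eq`. In both applications the determinant `b
c - a d` is `±(c² + s²)`, where `c`, `s` are the amplitude parameters. -/
theorem linCoeff_differential (m n k : ℕ) :
    c * ((k + 1) * linCoeff a b c d m n (k + 1)) - d * ((m + n - k) * linCoeff a b c d m n k) =
      m * (b * c - a * d) * linCoeff a b c d (m - 1) n k := by
  have h := congrArg (fun p => coeff p k) (linear_differential_eq (a := a) (b := b) (c := c)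
    (d := d) m n)
  simp only [coeff_sub, add_mul, coeff_add, mul_assoc, coeff_C_mul, coeff_derivative] at h
  have hX : (X * derivative ((C a + C b * X) ^ m * (C c + C d * X) ^ n)).coeff k =
      k * linCoeff a b c d m n k := by
    cases k with
    | zero => simp
    | succ k => rw [coeff_X_mul, coeff_derivative, linCoeff]; push_cast; ring
  rw [hX] at h
  simp only [coeff_eq_linCoeff] at h
  linear_combination h

end LinearForms

/-! ### Recursions for the two-mode amplitudes -/

section Amplitudes

/-- The square root of `n!`. -/
def sqrtFactorial (n : ℕ) : ℝ := √(n.factorial : ℝ)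

theorem sqrtFactorial_pos (n : ℕ) : 0 < sqrtFactorial n :=
  Real.sqrt_pos.2 (by exact_mod_cast n.factorial_pos)

theorem sqrtFactorial_succ (n : ℕ) : sqrtFactorial (n + 1) = √(n + 1) * sqrtFactorial n := by
  rw [sqrtFactorial, Nat.factorial_succ, Nat.cast_mul, Real.sqrt_mul (by positivity)]
  push_cast
  rfl

theorem sqrtFactorial_sq (n : ℕ) : sqrtFactorial n ^ 2 = n.factorial :=
  Real.sq_sqrt (by positivity)

/-- Fock amplitudes of the two-mode squeezer applied to `|k, n⟩`. -/
def squeezerAmplitude (c s : ℝ) (n k : ℕ) (p : ℕ × ℕ) : ℝ :=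
  if p.1 + n = p.2 + k then
    c * (sqrtFactorial k * sqrtFactorial p.2 / (sqrtFactorial p.1 * sqrtFactorial n)) *
      linCoeff s c c (-s) p.1 n k
  else 0

/-- Fock amplitudes of the beamsplitter applied to `|k, n⟩`. -/
def splitterAmplitude (c s : ℝ) (n k : ℕ) (p : ℕ × ℕ) : ℝ :=
  if p.1 + p.2 = k + n then
    sqrtFactorial p.1 * sqrtFactorial p.2 / (sqrtFactorial k * sqrtFactorial n) *
      linCoeff c s (-s) c k n p.2
  else 0

variable {c s : ℝ}

/-- The conjugated creation operator `U a₁† U† = c⁻¹ a₁† - (s / c) a₂` raises the input photon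
number. For the squeezer this uses the differential identity, while lowering only splits off one
linear factor; for the beamsplitter the roles are reversed. -/
theorem squeezerAmplitude_create (hc : c ≠ 0) (hcs : c ^ 2 + s ^ 2 = 1) (n k : ℕ) (p : ℕ × ℕ) :
    c⁻¹ * create₁ (squeezerAmplitude c s n k) p +
      (-(s / c)) * annihilate₂ (squeezerAmplitude c s n k) p =
      √(k + 1) * squeezerAmplitude c s n (k + 1) p := by
  obtain ⟨m, l⟩ := p
  simp only [create₁, annihilate₂, squeezerAmplitude]
  by_cases h : m + n = l + (k + 1)
  swap
  · rw [if_neg (show ¬ m + n = l + 1 + k by omega), if_neg h]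
    cases m with
    | zero => simp
    | succ m =>
      rw [if_neg (by omega)]
      simp
  have hk := sqrtFactorial_pos k
  have hl := sqrtFactorial_pos l
  have hn := sqrtFactorial_pos n
  have hm := sqrtFactorial_pos m
  have hcast : (m : ℝ) + n - k = l + 1 := by
    have : ((m + n : ℕ) : ℝ) = ((l + (k + 1) : ℕ) : ℝ) := by rw [h]
    push_cast at this
    linarith
  have hd := linCoeff_differential (a := s) (b := c) (c := c) (d := -s) m n k
  rw [hcast, show c * c - s * -s = 1 by linear_combination hcs, mul_one] at hd
  have hk2 : √((k : ℝ) + 1) ^ 2 = k + 1 := Real.sq_sqrt (by positivity)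
  have hl2 : √((l : ℝ) + 1) ^ 2 = l + 1 := Real.sq_sqrt (by positivity)
  rw [if_pos (show m + n = l + 1 + k by omega), if_pos h, sqrtFactorial_succ k,
    sqrtFactorial_succ l]
  cases m with
  | zero =>
    simp only [Nat.cast_zero, Real.sqrt_zero, zero_mul, mul_zero, zero_add] at hd ⊢
    field_simp
    rw [hk2, hl2]
    linear_combination (-1 : ℝ) * hd
  | succ m =>
    have hm' := sqrtFactorial_pos m
    have hm2 : 0 < √((m : ℝ) + 1) := Real.sqrt_pos.2 (by positivity)
    have hm3 : √((m : ℝ) + 1) ^ 2 = m + 1 := Real.sq_sqrt (by positivity)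
    simp only [Nat.add_sub_cancel] at hd ⊢
    rw [if_pos (show m + n = l + k by omega), sqrtFactorial_succ m]
    push_cast at hd ⊢
    field_simp
    rw [hk2, hl2, hm3]
    linear_combination (-1 : ℝ) * hd

theorem squeezerAmplitude_annihilate (hc : c ≠ 0) (n k : ℕ) (p : ℕ × ℕ) :
    c⁻¹ * annihilate₁ (squeezerAmplitude c s n (k + 1)) p +
      (-(s / c)) * create₂ (squeezerAmplitude c s n (k + 1)) p =
      √(k + 1) * squeezerAmplitude c s n k p := by
  obtain ⟨m, l⟩ := p
  simp only [create₂, annihilate₁, squeezerAmplitude]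
  by_cases h : m + n = l + k
  swap
  · rw [if_neg (by omega), if_neg h]
    cases l with
    | zero => simp
    | succ l =>
      rw [if_neg (by omega)]
      simp
  have hk := sqrtFactorial_pos k
  have hl := sqrtFactorial_pos l
  have hn := sqrtFactorial_pos n
  have hm := sqrtFactorial_pos m
  have hm2 : 0 < √((m : ℝ) + 1) := Real.sqrt_pos.2 (by positivity)
  rw [if_pos (show m + 1 + n = l + (k + 1) by omega), if_pos h, sqrtFactorial_succ k,
    sqrtFactorial_succ m, linCoeff_succ_left_succ]
  cases l with
  | zero =>
    -- For `l = 0` conservation gives `m + n = k`, so the index exceeds the degree.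
    rw [linCoeff_eq_zero_of_lt (show m + n < k + 1 by omega)]
    simp only [Nat.cast_zero, Real.sqrt_zero, zero_mul, mul_zero, add_zero, zero_add]
    field_simp
  | succ l =>
    have hl' := sqrtFactorial_pos l
    have hl2 : 0 < √((l : ℝ) + 1) := Real.sqrt_pos.2 (by positivity)
    rw [if_pos (show m + n = l + 1 - 1 + (k + 1) by omega), sqrtFactorial_succ l]
    simp only [Nat.add_sub_cancel]
    push_cast
    field_simp
    ring

theorem squeezerAmplitude_annihilate_zero (hc : c ≠ 0) (n : ℕ) (p : ℕ × ℕ) :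
    c⁻¹ * annihilate₁ (squeezerAmplitude c s n 0) p +
      (-(s / c)) * create₂ (squeezerAmplitude c s n 0) p = 0 := by
  obtain ⟨m, l⟩ := p
  simp only [create₂, annihilate₁, squeezerAmplitude, add_zero]
  cases l with
  | zero => simp
  | succ l =>
    simp only [Nat.add_sub_cancel]
    by_cases h : m + n = l
    · have hl := sqrtFactorial_pos l
      have hn := sqrtFactorial_pos n
      have hm := sqrtFactorial_pos m
      have hm2 : 0 < √((m : ℝ) + 1) := Real.sqrt_pos.2 (by positivity)
      rw [if_pos (by omega), if_pos h, sqrtFactorial_succ l, sqrtFactorial_succ m,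
        linCoeff_succ_left_zero]
      push_cast
      field_simp
      ring
    · rw [if_neg (by omega), if_neg h]
      simp

theorem splitterAmplitude_create (n k : ℕ) (p : ℕ × ℕ) :
    c * create₁ (splitterAmplitude c s n k) p + s * create₂ (splitterAmplitude c s n k) p =
      √(k + 1) * splitterAmplitude c s n (k + 1) p := by
  obtain ⟨m, l⟩ := p
  simp only [create₁, create₂, splitterAmplitude]
  have hk := sqrtFactorial_pos k
  have hn := sqrtFactorial_pos n
  have hk2 : 0 < √((k : ℝ) + 1) := Real.sqrt_pos.2 (by positivity)
  by_cases h : m + l = k + 1 + n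
  swap
  · rw [if_neg h]
    rcases m.eq_zero_or_pos with rfl | hm <;> rcases l.eq_zero_or_pos with rfl | hl
    · simp
    · rw [if_neg (show ¬ 0 + (l - 1) = k + n by omega)]
      simp
    · rw [if_neg (show ¬ m - 1 + 0 = k + n by omega)]
      simp
    · rw [if_neg (show ¬ m - 1 + l = k + n by omega), if_neg (show ¬ m + (l - 1) = k + n by omega)]
      simp
  rw [if_pos h, sqrtFactorial_succ k]
  have h1 : √(m : ℝ) * (if m - 1 + l = k + n then
      sqrtFactorial (m - 1) * sqrtFactorial l / (sqrtFactorial k * sqrtFactorial n) *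
        linCoeff c s (-s) c k n l else 0) =
      sqrtFactorial m * sqrtFactorial l / (sqrtFactorial k * sqrtFactorial n) *
        linCoeff c s (-s) c k n l := by
    cases m with
    | zero =>
      rw [linCoeff_eq_zero_of_lt (show k + n < l by omega)]
      simp
    | succ m =>
      rw [if_pos (by omega), sqrtFactorial_succ m, Nat.add_sub_cancel]
      push_cast
      ring
  rw [h1]
  cases l with
  | zero =>
    rw [linCoeff_succ_left_zero]
    simp only [Nat.cast_zero, Real.sqrt_zero, zero_mul, mul_zero, add_zero]
    field_simp
  | succ l =>
    rw [if_pos (by omega), linCoeff_succ_left_succ, sqrtFactorial_succ l, Nat.add_sub_cancel]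
    push_cast
    field_simp

theorem splitterAmplitude_annihilate_aux (hcs : c ^ 2 + s ^ 2 = 1) {n k m l : ℕ}
    (h : m + 1 + l = k + n) :
    c * annihilate₁ (splitterAmplitude c s n k) (m, l) +
      s * annihilate₂ (splitterAmplitude c s n k) (m, l) =
      sqrtFactorial m * sqrtFactorial l / (sqrtFactorial k * sqrtFactorial n) *
        (k * linCoeff c s (-s) c (k - 1) n l) := by
  simp only [annihilate₁, annihilate₂, splitterAmplitude]
  have hk := sqrtFactorial_pos k
  have hn := sqrtFactorial_pos n
  rw [if_pos h, if_pos (by omega), sqrtFactorial_succ, sqrtFactorial_succ]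
  have hm2 : √((m : ℝ) + 1) ^ 2 = m + 1 := Real.sq_sqrt (by positivity)
  have hl2 : √((l : ℝ) + 1) ^ 2 = l + 1 := Real.sq_sqrt (by positivity)
  have hcast : (k : ℝ) + n - l = m + 1 := by
    have : ((m + 1 + l : ℕ) : ℝ) = ((k + n : ℕ) : ℝ) := by rw [h]
    push_cast at this
    linarith
  have hd := linCoeff_differential (a := c) (b := s) (c := -s) (d := c) k n l
  rw [hcast, show s * -s - c * c = -1 by linear_combination -hcs] at hd
  field_simp
  rw [hm2, hl2]
  linear_combination (-(sqrtFactorial m * sqrtFactorial l)) * hd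

theorem splitterAmplitude_annihilate (hcs : c ^ 2 + s ^ 2 = 1) (n k : ℕ) (p : ℕ × ℕ) :
    c * annihilate₁ (splitterAmplitude c s n (k + 1)) p +
      s * annihilate₂ (splitterAmplitude c s n (k + 1)) p =
      √(k + 1) * splitterAmplitude c s n k p := by
  obtain ⟨m, l⟩ := p
  by_cases h : m + 1 + l = k + 1 + n
  · rw [splitterAmplitude_annihilate_aux hcs h, splitterAmplitude, if_pos (by simp; omega),
      sqrtFactorial_succ]
    have hk := sqrtFactorial_pos k
    have hn := sqrtFactorial_pos n
    have hk0 : 0 < √((k : ℝ) + 1) := Real.sqrt_pos.2 (by positivity)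
    have hk2 : √((k : ℝ) + 1) ^ 2 = k + 1 := Real.sq_sqrt (by positivity)
    simp only [Nat.add_sub_cancel]
    push_cast
    field_simp
    rw [hk2]
  · simp only [annihilate₁, annihilate₂, splitterAmplitude]
    rw [if_neg h, if_neg (by omega), if_neg (by omega)]
    simp

theorem splitterAmplitude_annihilate_zero (hcs : c ^ 2 + s ^ 2 = 1) (n : ℕ) (p : ℕ × ℕ) :
    c * annihilate₁ (splitterAmplitude c s n 0) p +
      s * annihilate₂ (splitterAmplitude c s n 0) p = 0 := by
  obtain ⟨m, l⟩ := p
  by_cases h : m + 1 + l = 0 + n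
  · rw [splitterAmplitude_annihilate_aux hcs h]
    simp
  · simp only [annihilate₁, annihilate₂, splitterAmplitude]
    rw [if_neg h, if_neg (by omega)]
    simp

end Amplitudes

/-! ### Normalization of the amplitudes -/

section Normalization

/-- `R` and `L` stand for the transformed creation and annihilation operators. The commutation
relation gives `(k + 1)‖v (k + 1)‖² = ‖L (v k)‖² + ‖v k‖² = k‖v (k - 1)‖² + ‖v k‖²`, a two-step
recursion whose solution is constant. -/
theorem rapidDecay_and_tsum_sq_eq_one {v : ℕ → ℕ × ℕ → ℝ}
    {R L : (ℕ × ℕ → ℝ) → ℕ × ℕ → ℝ}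
    (hR : ∀ f, RapidDecay f → RapidDecay (R f))
    (hRL : ∀ f, RapidDecay f → ∑' p, R f p ^ 2 = ∑' p, L f p ^ 2 + ∑' p, f p ^ 2)
    (hcreate : ∀ k p, R (v k) p = √(k + 1) * v (k + 1) p)
    (hannihilate : ∀ k p, L (v (k + 1)) p = √(k + 1) * v k p)
    (hzero : ∀ p, L (v 0) p = 0) (h0 : RapidDecay (v 0)) (h1 : ∑' p, v 0 p ^ 2 = 1) (k : ℕ) :
    RapidDecay (v k) ∧ ∑' p, v k p ^ 2 = 1 := by
  have hsq (k : ℕ) : √((k : ℝ) + 1) ^ 2 = k + 1 := Real.sq_sqrt (by positivity)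
  have hpos (k : ℕ) : (0 : ℝ) < k + 1 := by positivity
  have hdecay (k : ℕ) : RapidDecay (v k) := by
    induction k with
    | zero => exact h0
    | succ k ih =>
      have h := hR _ ih
      rw [funext (hcreate k)] at h
      -- The zero summand only gives the expression the shape of a linear combination of two
      -- amplitudes.
      have h2 : v (k + 1) = fun p => (√((k : ℝ) + 1))⁻¹ * (√(k + 1) * v (k + 1) p) +
          0 * (√(k + 1) * v (k + 1) p) := by
        ext p
        have := (Real.sqrt_pos.2 (hpos k)).ne'
        field_simp
        ring
      rw [h2]
      exact h.linear_comb h _ _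
  refine ⟨hdecay k, ?_⟩
  have hstep (k : ℕ) : (k + 1 : ℝ) * ∑' p, v (k + 1) p ^ 2 =
      ∑' p, L (v k) p ^ 2 + ∑' p, v k p ^ 2 := by
    rw [← hRL _ (hdecay k), ← tsum_mul_left]
    simp_rw [hcreate, mul_pow, hsq]
  induction k using Nat.strong_induction_on with
  | _ k ih =>
    rcases k with _ | _ | k
    · exact h1
    · have h := hstep 0
      simp_rw [hzero, h1] at h
      simpa using h
    · have h := hstep (k + 1)
      simp_rw [hannihilate, mul_pow, hsq, tsum_mul_left] at h
      rw [ih k (by omega), ih (k + 1) (by omega)] at h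
      push_cast at h
      have := hpos (k + 1)
      push_cast at this
      exact mul_left_cancel₀ this.ne' (by linarith)

theorem summable_succ_pow_mul_geometric (k : ℕ) {r : ℝ} (h0 : 0 ≤ r) (h1 : r < 1) :
    Summable fun m : ℕ => ((m : ℝ) + 1) ^ k * r ^ m := by
  have hr : ‖r‖ < 1 := by rwa [Real.norm_of_nonneg h0]
  refine Summable.of_nonneg_of_le (fun m => by positivity) (fun m => ?_)
    (((summable_pow_mul_geometric_of_norm_lt_one k hr).mul_left (2 ^ k)).add
      (summable_geometric_of_lt_one h0 h1))
  have h : ((m : ℝ) + 1) ^ k ≤ 2 ^ k * (m : ℝ) ^ k + 1 := by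
    cases m with
    | zero => simp
    | succ m =>
      rw [← mul_pow]
      refine le_add_of_le_of_nonneg ?_ zero_le_one
      gcongr
      push_cast
      linarith [(Nat.cast_nonneg m : (0 : ℝ) ≤ m)]
  calc _ ≤ (2 ^ k * (m : ℝ) ^ k + 1) * r ^ m := by gcongr
    _ = _ := by ring

variable {c s : ℝ}

theorem squeezerAmplitude_zero_sq (n m : ℕ) : squeezerAmplitude c s n 0 (m, m + n) ^ 2 =
    c ^ 2 * (c ^ 2) ^ n * ((m + n).choose n * (s ^ 2) ^ m) := by
  rw [squeezerAmplitude, if_pos (by simp), linCoeff_zero_eq_zero_index, mul_pow, mul_pow, div_pow,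
    mul_pow, mul_pow, sqrtFactorial_sq, sqrtFactorial_sq, sqrtFactorial_sq, sqrtFactorial_sq,
    Nat.add_comm m n, Nat.cast_add_choose ℝ]
  simp only [Nat.factorial_zero, Nat.cast_one, one_mul]
  ring

theorem injective_diagonal (n : ℕ) : Function.Injective fun m : ℕ => (m, m + n) :=
  fun _ _ h => (Prod.ext_iff.1 h).1

theorem squeezerAmplitude_zero_eq_zero {n : ℕ} {p : ℕ × ℕ}
    (hp : p ∉ Set.range fun m : ℕ => (m, m + n)) : squeezerAmplitude c s n 0 p = 0 := by
  rw [squeezerAmplitude, if_neg]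
  intro h
  exact hp ⟨p.1, Prod.ext rfl h⟩

theorem rapidDecay_squeezerAmplitude_zero (hc : c ≠ 0) (hcs : c ^ 2 + s ^ 2 = 1) (n : ℕ) :
    RapidDecay (squeezerAmplitude c s n 0) := by
  intro q
  have hc2 : 0 < c ^ 2 := by positivity
  refine ((injective_diagonal n).summable_iff fun p hp => ?_).1 ?_
  · rw [squeezerAmplitude_zero_eq_zero hp]
    simp
  refine Summable.of_nonneg_of_le (fun m => by simp only [Function.comp]; positivity) (fun m => ?_)
    ((summable_succ_pow_mul_geometric (q + n) (sq_nonneg s) (by linarith)).mul_left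
      (c ^ 2 * (c ^ 2) ^ n * (n + 2) ^ (q + n)))
  simp only [Function.comp, squeezerAmplitude_zero_sq]
  have hm : (0 : ℝ) ≤ m := by positivity
  have hn : (0 : ℝ) ≤ n := by positivity
  have h1 : ((m : ℝ) + (m + n : ℕ) + 1) ^ q ≤ ((n + 2) * (m + 1)) ^ q := by
    gcongr
    push_cast
    nlinarith
  have h2 : (((m + n).choose n : ℕ) : ℝ) ≤ ((n + 2) * (m + 1)) ^ n := by
    calc (((m + n).choose n : ℕ) : ℝ) ≤ (m + n : ℝ) ^ n := by
          exact_mod_cast Nat.choose_le_pow (m + n) n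
      _ ≤ _ := by
          gcongr
          nlinarith
  calc _ ≤ ((n + 2) * (m + 1) : ℝ) ^ q *
        (c ^ 2 * (c ^ 2) ^ n * (((n + 2) * (m + 1)) ^ n * (s ^ 2) ^ m)) := by gcongr
    _ = _ := by
        rw [mul_pow, mul_pow, pow_add, pow_add]
        ring

/-- The support is the diagonal `(m, m + n)`, and the sum there is the negative binomial series with
value `(1 - s²)⁻¹ ^ (n + 1)`. -/
theorem tsum_squeezerAmplitude_zero_sq (hc : c ≠ 0) (hcs : c ^ 2 + s ^ 2 = 1) (n : ℕ) :
    ∑' p, squeezerAmplitude c s n 0 p ^ 2 = 1 := by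
  have hc2 : 0 < c ^ 2 := by positivity
  have hs : ‖s ^ 2‖ < 1 := by
    rw [Real.norm_of_nonneg (sq_nonneg s)]
    linarith
  refine (((injective_diagonal n).hasSum_iff fun p hp => ?_).1 ?_).tsum_eq
  · rw [squeezerAmplitude_zero_eq_zero hp]
    simp
  have h := (hasSum_choose_mul_geometric_of_norm_lt_one n hs).mul_left (c ^ 2 * (c ^ 2) ^ n)
  rw [show 1 - s ^ 2 = c ^ 2 by linarith, ← pow_succ',
    mul_one_div_cancel (pow_ne_zero _ hc2.ne')] at h
  rw [pow_succ'] at h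
  exact (congrArg (HasSum · _) (funext fun m => (squeezerAmplitude_zero_sq n m).symm)).mp h

theorem hasSum_squeezerAmplitude_sq (hc : c ≠ 0) (hcs : c ^ 2 + s ^ 2 = 1) (n k : ℕ) :
    HasSum (fun p => squeezerAmplitude c s n k p ^ 2) 1 := by
  have h := rapidDecay_and_tsum_sq_eq_one (v := squeezerAmplitude c s n)
    (R := fun f p => c⁻¹ * create₁ f p + (-(s / c)) * annihilate₂ f p)
    (L := fun f p => c⁻¹ * annihilate₁ f p + (-(s / c)) * create₂ f p)
    (fun f hf => hf.create₁.linear_comb hf.annihilate₂ _ _)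
    (fun f hf => tsum_squeezed_create_sq hf (by field_simp; linarith))
    (squeezerAmplitude_create hc hcs n) (squeezerAmplitude_annihilate hc n)
    (squeezerAmplitude_annihilate_zero hc n) (rapidDecay_squeezerAmplitude_zero hc hcs n)
    (tsum_squeezerAmplitude_zero_sq hc hcs n) k
  rw [← h.2]
  exact Summable.hasSum (by simpa using h.1 0)

theorem splitterAmplitude_zero_sq (n : ℕ) {p : ℕ × ℕ}
    (hp : p ∈ Finset.HasAntidiagonal.antidiagonal n) :
    splitterAmplitude c s n 0 p ^ 2 = n.choose p.1 • ((s ^ 2) ^ p.1 * (c ^ 2) ^ p.2) := by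
  obtain ⟨m, l⟩ := p
  dsimp only at *
  obtain rfl : m + l = n := Finset.HasAntidiagonal.mem_antidiagonal.1 hp
  rw [splitterAmplitude, if_pos (by simp), linCoeff_zero_left, mul_pow, div_pow,
    mul_pow, mul_pow, sqrtFactorial_sq, sqrtFactorial_sq, sqrtFactorial_sq, sqrtFactorial_sq,
    nsmul_eq_mul, ← Nat.choose_symm_add (a := m), Nat.add_sub_cancel, Nat.cast_add_choose ℝ,
    Nat.factorial_zero, Nat.cast_one, mul_pow, ← pow_mul (-s), pow_mul' (-s), neg_sq]
  field_simp
  rw [pow_right_comm c l 2, mul_comm]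

theorem splitterAmplitude_zero_eq_zero (n : ℕ) {p : ℕ × ℕ}
    (hp : p ∉ Finset.HasAntidiagonal.antidiagonal n) :
    splitterAmplitude c s n 0 p = 0 := by
  rw [splitterAmplitude, if_neg]
  simpa using hp

theorem hasSum_splitterAmplitude_sq (hcs : c ^ 2 + s ^ 2 = 1) (n k : ℕ) :
    HasSum (fun p => splitterAmplitude c s n k p ^ 2) 1 := by
  have h0 : ∑' p, splitterAmplitude c s n 0 p ^ 2 = 1 := by
    rw [tsum_eq_sum (s := Finset.HasAntidiagonal.antidiagonal n) fun p hp => by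
        rw [splitterAmplitude_zero_eq_zero n hp]; simp,
      Finset.sum_congr rfl fun p hp => splitterAmplitude_zero_sq n hp,
      ← (Commute.all _ _).add_pow', add_comm, hcs, one_pow]
  have h := rapidDecay_and_tsum_sq_eq_one (v := splitterAmplitude c s n)
    (R := fun f p => c * create₁ f p + s * create₂ f p)
    (L := fun f p => c * annihilate₁ f p + s * annihilate₂ f p)
    (fun f hf => hf.create₁.linear_comb hf.create₂ _ _)
    (fun f hf => tsum_rotated_create_sq hf hcs)
    (splitterAmplitude_create n) (splitterAmplitude_annihilate hcs n)
    (splitterAmplitude_annihilate_zero hcs n)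
    (fun q => summable_of_ne_finset_zero (s := Finset.HasAntidiagonal.antidiagonal n) fun p hp => by
      rw [splitterAmplitude_zero_eq_zero n hp]; simp) h0 k
  rw [← h.2]
  exact Summable.hasSum (by simpa using h.1 0)

end Normalization

/-! ### Identification of the Fock matrix elements -/

section Identification

variable {c s : ℝ}

theorem sqrt_factorial_div (a b m n : ℕ) :
    √((a.factorial * b.factorial : ℝ) / (m.factorial * n.factorial)) =
      sqrtFactorial a * sqrtFactorial b / (sqrtFactorial m * sqrtFactorial n) := by
  rw [Real.sqrt_div (by positivity), Real.sqrt_mul (by positivity), Real.sqrt_mul (by positivity)]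
  rfl

/-- Of the two Kronecker symbols one selects the coefficient and the other, given the first, is
photon-number conservation `P`, which does not depend on the summation indices. -/
theorem sum_ite_and_eq (P : Prop) [Decidable P] {m n k : ℕ} {Q : ℕ → ℕ → Prop}
    [∀ r j, Decidable (Q r j)] {f g : ℕ → ℕ → ℝ}
    (hQ : ∀ r ≤ m, ∀ j ≤ n, Q r j ↔ (k = r + j ∧ P))
    (hfg : ∀ r ≤ m, ∀ j ≤ n, k = r + j → P → f r j = g r j) :
    (∑ r ∈ Finset.range (m + 1), ∑ j ∈ Finset.range (n + 1), if Q r j then f r j else 0) =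
      if P then ∑ r ∈ Finset.range (m + 1), ∑ j ∈ Finset.range (n + 1),
        (if k = r + j then g r j else 0) else 0 := by
  by_cases hP : P
  · rw [if_pos hP]
    refine Finset.sum_congr rfl fun r hr => Finset.sum_congr rfl fun j hj => ?_
    have hr' : r ≤ m := by simpa [Nat.lt_succ_iff] using hr
    have hj' : j ≤ n := by simpa [Nat.lt_succ_iff] using hj
    by_cases h : k = r + j
    · rw [if_pos ((hQ r hr' j hj').2 ⟨h, hP⟩), if_pos h, hfg r hr' j hj' h hP]
    · rw [if_neg fun h' => h ((hQ r hr' j hj').1 h').1, if_neg h]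
  · rw [if_neg hP]
    refine Finset.sum_eq_zero fun r hr => Finset.sum_eq_zero fun j hj => if_neg fun h => ?_
    exact hP ((hQ r (by simpa [Nat.lt_succ_iff] using hr) j
      (by simpa [Nat.lt_succ_iff] using hj)).1 h).2

theorem amplifierMatrix_eq (κ : ℝ) (m₁ m₂ n₁ n₂ : ℕ) : amplifierMatrix κ m₁ m₂ n₁ n₂ =
    squeezerAmplitude κ⁻¹ √(1 - κ⁻¹ ^ 2) n₂ n₁ (m₁, m₂) := by
  rw [amplifierMatrix, squeezerAmplitude, sqrt_factorial_div, Finset.sum_comm,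
    sum_ite_and_eq (m₁ + n₂ = m₂ + n₁) (k := n₁) (fun r hr j hj => by omega)
      (fun r hr j hj hk hP => ?_), ← linCoeff_eq_sum √(1 - κ⁻¹ ^ 2) κ⁻¹ κ⁻¹ (-√(1 - κ⁻¹ ^ 2)),
    mul_ite, mul_zero]
  rw [show n₂ + r - j = r + (n₂ - j) by omega, show m₁ + j - r = j + (m₁ - r) by omega, pow_add,
    pow_add, neg_pow √(1 - κ⁻¹ ^ 2)]
  ring

theorem conjugatorMatrix_eq (κ : ℝ) (m₁ m₂ n₁ n₂ : ℕ) : conjugatorMatrix κ m₁ m₂ n₁ n₂ =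
    squeezerAmplitude (√(1 + κ ^ 2))⁻¹ (κ / √(1 + κ ^ 2)) n₁ n₂ (m₁, m₂) := by
  rw [conjugatorMatrix, squeezerAmplitude, sqrt_factorial_div,
    sum_ite_and_eq (m₁ + n₁ = m₂ + n₂) (k := n₂) (fun r hr j hj => by omega)
      (fun r hr j hj hk hP => ?_), ← linCoeff_eq_sum (κ / √(1 + κ ^ 2)) (√(1 + κ ^ 2))⁻¹
        (√(1 + κ ^ 2))⁻¹ (-(κ / √(1 + κ ^ 2))),
    mul_ite, mul_zero]
  rw [show n₁ + r - j = r + (n₁ - j) by omega, pow_add, pow_add, neg_pow (κ / √(1 + κ ^ 2))]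
  ring

theorem attenuatorMatrix_eq (κ : ℝ) (m₁ m₂ n₁ n₂ : ℕ) : attenuatorMatrix κ m₁ m₂ n₁ n₂ =
    splitterAmplitude κ √(1 - κ ^ 2) n₂ n₁ (m₁, m₂) := by
  rw [attenuatorMatrix, splitterAmplitude, sqrt_factorial_div,
    sum_ite_and_eq (m₁ + m₂ = n₁ + n₂) (k := m₂) (fun r hr j hj => by omega)
      (fun r hr j hj hk hP => ?_), ← linCoeff_eq_sum κ √(1 - κ ^ 2) (-√(1 - κ ^ 2)) κ,
    mul_ite, mul_zero]
  rw [show r + n₂ - j = r + (n₂ - j) by omega, pow_add, pow_add, neg_pow √(1 - κ ^ 2)]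
  ring

/-! ### Exchange symmetries of the amplitudes -/

/-- Reversing the coefficients of a product of linear forms exchanges the two entries of each form;
the sign comes from `s - c X = -(-s + c X)`. -/
theorem linCoeff_reflect {k n m l : ℕ} (h : m + l = k + n) :
    linCoeff s c (-c) s k n l = (-1) ^ n * linCoeff c s (-s) c k n m := by
  rw [linCoeff_eq_sum, linCoeff_eq_sum, ← Finset.sum_range_reflect, Finset.mul_sum]
  refine Finset.sum_congr rfl fun r hr => ?_
  rw [← Finset.sum_range_reflect, Finset.mul_sum]
  refine Finset.sum_congr rfl fun j hj => ?_
  have hr' : r ≤ k := by simpa [Nat.lt_succ_iff] using hr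
  have hj' : j ≤ n := by simpa [Nat.lt_succ_iff] using hj
  simp only [Nat.add_sub_cancel]
  by_cases hm : m = r + j
  · rw [if_pos hm, if_pos (by omega), Nat.choose_symm hr', Nat.choose_symm hj',
      Nat.sub_sub_self hr', Nat.sub_sub_self hj', neg_pow c, neg_pow s]
    obtain ⟨t, rfl⟩ := Nat.exists_eq_add_of_le hj'
    rw [Nat.add_sub_cancel_left, pow_add]
    have : ((-1 : ℝ) ^ t) * (-1) ^ t = 1 := by rw [← mul_pow]; simp
    linear_combination (-(k.choose r : ℝ) * c ^ (k - r) * s ^ r * (j + t).choose j * s ^ t *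
      (-1) ^ j * c ^ j) * this
  · rw [if_neg hm, if_neg (by omega), mul_zero]

theorem splitterAmplitude_swap (n k m l : ℕ) :
    splitterAmplitude s c n k (m, l) = (-1) ^ n * splitterAmplitude c s n k (l, m) := by
  simp only [splitterAmplitude]
  by_cases h : m + l = k + n
  · rw [if_pos h, if_pos (by omega), linCoeff_reflect h]
    ring
  · rw [if_neg h, if_neg (by omega), mul_zero]

/-- With `m = r + u`, `n = j + t`, `k = r + j`, `l = t + u`, each term on the left carries the
coefficient `k! l! m! n! / (r! u! j! t!)`. It is unchanged when `r` and `t` are exchanged, which is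
the bijection used. -/
theorem factorial_mul_linCoeff {m n l k : ℕ} (h : m + n = l + k) :
    (k.factorial : ℝ) * l.factorial * linCoeff s c c (-s) m n k =
      n.factorial * m.factorial * linCoeff s c c (-s) l k n := by
  rw [linCoeff_eq_sum, linCoeff_eq_sum, ← Finset.sum_product', ← Finset.sum_product',
    ← Finset.sum_filter, ← Finset.sum_filter, Finset.mul_sum, Finset.mul_sum]
  refine Finset.sum_nbij' (fun p => (n - p.2, p.2)) (fun p => (k - p.2, p.2)) ?_ ?_ ?_ ?_ ?_
  · rintro ⟨r, j⟩ hp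
    simp only [Finset.mem_filter, Finset.mem_product, Finset.mem_range] at hp ⊢
    omega
  · rintro ⟨r, j⟩ hp
    simp only [Finset.mem_filter, Finset.mem_product, Finset.mem_range] at hp ⊢
    omega
  · rintro ⟨r, j⟩ hp
    simp only [Finset.mem_filter, Finset.mem_product, Finset.mem_range] at hp
    simp only [Prod.mk.injEq, and_true]
    omega
  · rintro ⟨r, j⟩ hp
    simp only [Finset.mem_filter, Finset.mem_product, Finset.mem_range] at hp
    simp only [Prod.mk.injEq, and_true]
    omega
  · rintro ⟨r, j⟩ hp
    simp only [Finset.mem_filter, Finset.mem_product, Finset.mem_range] at hp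
    obtain ⟨⟨hr, hj⟩, rfl⟩ := hp
    obtain ⟨u, rfl⟩ := Nat.exists_eq_add_of_le (Nat.lt_succ_iff.1 hr)
    obtain ⟨t, rfl⟩ := Nat.exists_eq_add_of_le (Nat.lt_succ_iff.1 hj)
    obtain rfl : l = t + u := by omega
    simp only [Nat.add_sub_cancel_left, Nat.add_sub_cancel]
    rw [Nat.cast_add_choose, Nat.cast_add_choose, Nat.cast_add_choose,
      ← Nat.choose_symm_add (a := r), Nat.cast_add_choose]
    field_simp

theorem squeezerAmplitude_swap (n k m l : ℕ) :
    squeezerAmplitude c s n k (m, l) = squeezerAmplitude c s k n (l, m) := by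
  simp only [squeezerAmplitude]
  by_cases h : m + n = l + k
  · rw [if_pos h, if_pos h.symm]
    have h1 := factorial_mul_linCoeff (s := s) (c := c) h
    simp only [← sqrtFactorial_sq] at h1
    have hk := sqrtFactorial_pos k
    have hl := sqrtFactorial_pos l
    have hn := sqrtFactorial_pos n
    have hm := sqrtFactorial_pos m
    field_simp
    linear_combination c * h1
  · rw [if_neg h, if_neg (Ne.symm h)]

/-- Both are squeezer amplitudes with `c = κ⁻¹`, the conjugator having its inputs exchanged. The
squeezer treats its modes symmetrically, so exchanging the inputs amounts to exchanging the outputs.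
-/
theorem conjugatorMatrix_eq_amplifierMatrix {κ : ℝ} (hκ : 1 ≤ κ) (m l k n : ℕ) :
    conjugatorMatrix √(κ ^ 2 - 1) m l k n = amplifierMatrix κ l m k n := by
  have h1 : 0 ≤ κ ^ 2 - 1 := by nlinarith
  have h2 : √(1 + √(κ ^ 2 - 1) ^ 2) = κ := by
    rw [Real.sq_sqrt h1, add_sub_cancel, Real.sqrt_sq (by linarith)]
  have h3 : √(κ ^ 2 - 1) / κ = √(1 - κ⁻¹ ^ 2) := by
    have : (1 - κ⁻¹ ^ 2) = (κ ^ 2 - 1) / κ ^ 2 := by field_simp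
    rw [this, Real.sqrt_div h1, Real.sqrt_sq (by linarith)]
  rw [conjugatorMatrix_eq, amplifierMatrix_eq, h2, h3, squeezerAmplitude_swap]

theorem attenuatorMatrix_swap {κ : ℝ} (h0 : 0 ≤ κ) (h1 : κ ≤ 1) (m l k n : ℕ) :
    attenuatorMatrix √(1 - κ ^ 2) m l k n = (-1) ^ n * attenuatorMatrix κ l m k n := by
  have h2 : √(1 - √(1 - κ ^ 2) ^ 2) = κ := by
    rw [Real.sq_sqrt (by nlinarith), sub_sub_cancel, Real.sqrt_sq h0]
  rw [attenuatorMatrix_eq, attenuatorMatrix_eq, h2, splitterAmplitude_swap]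

/-! ### The three Kraus families -/

variable {H : Type*} [NormedAddCommGroup H] [InnerProductSpace ℂ H] (e : HilbertBasis ℕ ℂ H)

theorem isKrausFamily_amplifierMatrix {κ : ℝ} (hκ : 1 ≤ κ) (n : ℕ) :
    IsKrausFamily e (amplifierMatrix κ) n := by
  have h0 : 0 < κ := by linarith
  have hinv : κ⁻¹ ≤ 1 := inv_le_one_of_one_le₀ hκ
  have hinv0 : 0 < κ⁻¹ := by positivity
  refine isKrausFamily_of_hasSum e (fun m l k k' h h' => ?_) fun k => ?_
  · rw [amplifierMatrix_eq, squeezerAmplitude] at h h'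
    have := (ite_ne_right_iff.1 h).1
    have := (ite_ne_right_iff.1 h').1
    simp only at *
    omega
  · simp_rw [amplifierMatrix_eq]
    exact hasSum_squeezerAmplitude_sq hinv0.ne' (by rw [Real.sq_sqrt (by nlinarith)]; ring) n k

theorem isKrausFamily_conjugatorMatrix {κ : ℝ} (hκ : 1 ≤ κ) (n : ℕ) :
    IsKrausFamily e (conjugatorMatrix √(κ ^ 2 - 1)) n := by
  have h0 : 0 < κ := by linarith
  have hinv : κ⁻¹ ≤ 1 := inv_le_one_of_one_le₀ hκ
  have hinv0 : 0 < κ⁻¹ := by positivity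
  refine isKrausFamily_of_hasSum e (fun m l k k' h h' => ?_) fun k => ?_
  · rw [conjugatorMatrix_eq, squeezerAmplitude] at h h'
    have := (ite_ne_right_iff.1 h).1
    have := (ite_ne_right_iff.1 h').1
    simp only at *
    omega
  · simp_rw [conjugatorMatrix_eq_amplifierMatrix hκ, amplifierMatrix_eq]
    have h := hasSum_squeezerAmplitude_sq (s := √(1 - κ⁻¹ ^ 2)) hinv0.ne'
      (by rw [Real.sq_sqrt (by nlinarith)]; ring) n k
    exact (Equiv.prodComm ℕ ℕ).hasSum_iff
      (f := fun p => squeezerAmplitude κ⁻¹ √(1 - κ⁻¹ ^ 2) n k p ^ 2).2 h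

theorem isKrausFamily_attenuatorMatrix {κ : ℝ} (h0 : 0 ≤ κ) (h1 : κ ≤ 1) (n : ℕ) :
    IsKrausFamily e (attenuatorMatrix κ) n := by
  refine isKrausFamily_of_hasSum e (fun m l k k' h h' => ?_) fun k => ?_
  · rw [attenuatorMatrix_eq, splitterAmplitude] at h h'
    have := (ite_ne_right_iff.1 h).1
    have := (ite_ne_right_iff.1 h').1
    simp only at *
    omega
  · simp_rw [attenuatorMatrix_eq]
    exact hasSum_splitterAmplitude_sq (by rw [Real.sq_sqrt (by nlinarith)]; ring) n k

end Identification

end PhotonAdded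

end

theorem mainTheorem11 {H : Type*} [NormedAddCommGroup H] [InnerProductSpace ℂ H] [CompleteSpace H]
    (e : HilbertBasis ℕ ℂ H) (n : ℕ) :
    (∀ κ : ℝ, 1 ≤ κ →
      PhotonAdded.IsKrausFamily e (PhotonAdded.amplifierMatrix κ) n ∧
      PhotonAdded.IsKrausFamily e (PhotonAdded.conjugatorMatrix (√(κ ^ 2 - 1))) n ∧
      PhotonAdded.minOutputEntropy e (PhotonAdded.amplifier e κ n) =
        PhotonAdded.minOutputEntropy e (PhotonAdded.conjugator e (√(κ ^ 2 - 1)) n)) ∧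
    (∀ κ : ℝ, 0 ≤ κ → κ ≤ 1 →
      PhotonAdded.IsKrausFamily e (PhotonAdded.attenuatorMatrix κ) n ∧
      PhotonAdded.IsKrausFamily e (PhotonAdded.attenuatorMatrix (√(1 - κ ^ 2))) n ∧
      PhotonAdded.minOutputEntropy e (PhotonAdded.attenuator e κ n) =
        PhotonAdded.minOutputEntropy e (PhotonAdded.attenuator e (√(1 - κ ^ 2)) n)) := by
  refine ⟨fun κ hκ => ?_, fun κ h0 h1 => ?_⟩
  · have hA := PhotonAdded.isKrausFamily_amplifierMatrix e hκ n
    have hC := PhotonAdded.isKrausFamily_conjugatorMatrix e hκ n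
    have h := PhotonAdded.minOutputEntropy_eq_of_complementary hA hC (ε := 1) (by norm_num)
      fun m l k => by rw [one_mul, PhotonAdded.conjugatorMatrix_eq_amplifierMatrix hκ]
    exact ⟨hA, hC, h⟩
  · have h2 : √(1 - κ ^ 2) ≤ 1 := Real.sqrt_le_one.2 (by nlinarith)
    have hB := PhotonAdded.isKrausFamily_attenuatorMatrix e h0 h1 n
    have hB' := PhotonAdded.isKrausFamily_attenuatorMatrix e (Real.sqrt_nonneg (1 - κ ^ 2)) h2 n
    have h := PhotonAdded.minOutputEntropy_eq_of_complementary hB hB' (ε := (-1) ^ n)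
      (by rw [← mul_pow]; simp) fun m l k => PhotonAdded.attenuatorMatrix_swap h0 h1 m l k n
    exact ⟨hB, hB', h⟩
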